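/- Let $\mathbb T^2=\mathbb R^2/\mathbb Z^2$ with its normalized Lebesgue measure, and write $\widehat f(\alpha)=\int_{\mathbb T^2}e^{-2\pi i\alpha\cdot x}f(x)\,dx$ for $f\in L^1(\mathbb T^2)$ and $\alpha\in\mathbb Z^2$. Let $\chi\in C_c^\infty(\mathbb R^2)$ be nonnegative and radial, supported in the unit ball, with $\chi(\xi)=1$ for $|\xi|\le 1/2$. Put $\lambda_q=2^q$, $\varphi(\xi)=\chi(\xi/2)-\chi(\xi)$, and for integers $q\ge 0$ \[ \Delta_q f=\sum_{\alpha\in\mathbb Z^2}\varphi(\lambda_q^{-1}\alpha)\widehat f(\alpha)e^{2\pi i\alpha\cdot x},\qquad S_q[f]=\sum_{\alpha\in\mathbb Z^2}\chi(\lambda_q^{-1}\alpha)\widehat f(\alpha)e^{2\pi i\alpha\cdot x} \] (acting componentwise on vector fields). An integrable $u$ belongs to $B^{1/3}_{3,\infty}(\mathbb T^2)$ if $\sup_{q\ge0}\lambda_q^{1/3}\|\Delta_q u\|_{L^3(\mathbb T^2)}<\infty$. Then there exists a real vector field $u:\mathbb T^2\to\mathbb R^2$, divergence-free in the sense of distributions,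 such that $u\in B^{1/3}_{3,\infty}(\mathbb T^2)$ and $u\in W^{1,p}(\mathbb T^2)$ for every $1\le p<3/2$ (the same $u$ for all $p$), so that in particular $(u\cdot\nabla)u$, formed with the weak gradient of $u$, is integrable, and such that the energy flux \[ \Pi_q[u]=\int_{\mathbb T^2}S_q[u]\cdot S_q[(u\cdot\nabla)u]\,dx \] satisfies $\limsup_{q\to\infty}\Pi_q[u]\neq 0$. -/

import Mathlib

open MeasureTheory Filter
open scoped ENNReal NNReal ContDiff

noncomputable section

/-- The torus `𝕋² = ℝ² / ℤ²`. -/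
abbrev Torus2 : Type := UnitAddTorus (Fin 2)

/-- The Lebesgue measure of the torus, which has total mass `1`. It is the measure with respect to
which `UnitAddTorus.mFourierCoeff` integrates. -/
abbrev torusMeasure : Measure Torus2 := Measure.pi fun _ => AddCircle.haarAddCircle

/-- Vectors of the Euclidean plane. -/
abbrev Plane : Type := EuclideanSpace ℝ (Fin 2)

/-! ### Littlewood–Paley theory -/

/-- The admissible cut-off functions: `χ ∈ C_c^∞(ℝ²)` is nonnegative and radial, is supported in
the unit ball, and equals `1` where `|ξ| ≤ 1/2`. -/
structure IsCutoff (χ : Plane → ℝ) : Prop where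
  smooth : ContDiff ℝ ∞ χ
  nonneg : ∀ ξ, 0 ≤ χ ξ
  radial : ∀ ξ η : Plane, ‖ξ‖ = ‖η‖ → χ ξ = χ η
  support_subset : tsupport χ ⊆ Metric.closedBall 0 1
  eq_one : ∀ ξ : Plane, ‖ξ‖ ≤ 1 / 2 → χ ξ = 1

/-- The frequency `α ∈ ℤ²` as a vector of the plane. -/
def freq (α : Fin 2 → ℤ) : Plane := WithLp.toLp 2 fun i => (α i : ℝ)

/-- The Fourier multiplier `f ↦ ∑_α m(λ_q⁻¹ α) f̂(α) e^{2πi α·x}`, where `λ_q = 2^q`. For `m` of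
compact support only finitely many terms are nonzero. -/
def dyadicMultiplier (m : Plane → ℝ) (q : ℕ) (f : Torus2 → ℝ) (x : Torus2) : ℂ :=
  ∑' α : Fin 2 → ℤ, (m (((2 : ℝ) ^ q)⁻¹ • freq α) : ℂ) *
    UnitAddTorus.mFourierCoeff (fun y => (f y : ℂ)) α * UnitAddTorus.mFourier α x

/-- The profile `φ(ξ) = χ(ξ/2) - χ(ξ)` of the dyadic shells. -/
def shell (χ : Plane → ℝ) (ξ : Plane) : ℝ := χ ((2 : ℝ)⁻¹ • ξ) - χ ξ

/-- The Littlewood–Paley component `Δ_q f`. -/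
def lpComponent (χ : Plane → ℝ) (q : ℕ) (f : Torus2 → ℝ) : Torus2 → ℂ :=
  dyadicMultiplier (shell χ) q f

/-- The Littlewood–Paley truncation `S_q[f]`. -/
def lpTruncation (χ : Plane → ℝ) (q : ℕ) (f : Torus2 → ℝ) : Torus2 → ℂ :=
  dyadicMultiplier χ q f

/-- `u ∈ B^s_{p,∞}(𝕋²)` for `s > 0`: `u` is integrable and `sup_{q ≥ 0} λ_q^s ‖Δ_q u‖_{L^p} < ∞`,
componentwise. The components `Δ_q` with `q < 0` vanish on the torus, and the only remaining
frequency, the mean `û(0)`, is finite. -/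
def MemBesovTop (χ : Plane → ℝ) (s : ℝ) (p : ℝ≥0∞) (u : Torus2 → Plane) : Prop :=
  ∀ i, Integrable (fun x => u x i) torusMeasure ∧
    ∃ C : ℝ≥0, ∀ q : ℕ,
      ENNReal.ofReal (((2 : ℝ) ^ q) ^ s) * eLpNorm (lpComponent χ q fun x => u x i) p torusMeasure ≤ C

/-! ### Weak derivatives on the torus -/

/-- Smooth real functions on the torus: the periodic lift to `ℝ²` is `C^∞`. -/
def IsTestFunction (φ : Torus2 → ℝ) : Prop :=
  ContDiff ℝ ∞ fun y : Fin 2 → ℝ => φ fun i => (y i : UnitAddCircle)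

/-- The classical partial derivative `∂_j φ` of a function on the torus. -/
def torusPartial (j : Fin 2) (φ : Torus2 → ℝ) (x : Torus2) : ℝ :=
  deriv (fun t : ℝ => φ (x + Pi.single j (t : UnitAddCircle))) 0

/-- `G` is the weak gradient of the vector field `u`, with `G x i j = ∂_j u_i (x)`. -/
def HasWeakGradient (u : Torus2 → Plane) (G : Torus2 → Matrix (Fin 2) (Fin 2) ℝ) : Prop :=
  (∀ i, Integrable (fun x => u x i) torusMeasure) ∧
    (∀ i j, Integrable (fun x => G x i j) torusMeasure) ∧
    ∀ i j, ∀ φ : Torus2 → ℝ, IsTestFunction φ →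
      ∫ x, u x i * torusPartial j φ x ∂torusMeasure = -∫ x, G x i j * φ x ∂torusMeasure

/-- `u ∈ W^{1,p}(𝕋²)`: `u` and its weak gradient are in `L^p`. -/
def MemSobolevOne (p : ℝ≥0∞) (u : Torus2 → Plane) : Prop :=
  (∀ i, MemLp (fun x => u x i) p torusMeasure) ∧
    ∃ G, HasWeakGradient u G ∧ ∀ i j, MemLp (fun x => G x i j) p torusMeasure

/-- `div u = 0` in the sense of distributions. -/
def IsDivergenceFree (u : Torus2 → Plane) : Prop :=
  (∀ i, Integrable (fun x => u x i) torusMeasure) ∧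
    ∀ φ : Torus2 → ℝ, IsTestFunction φ → ∫ x, ∑ j, u x j * torusPartial j φ x ∂torusMeasure = 0

/-! ### The energy flux -/

/-- The `i`-th component `∑_j u_j ∂_j u_i` of `(u · ∇) u`, where `G` is the weak gradient of `u`. -/
def advection (u : Torus2 → Plane) (G : Torus2 → Matrix (Fin 2) (Fin 2) ℝ) (i : Fin 2)
    (x : Torus2) : ℝ :=
  ∑ j, u x j * G x i j

/-- The energy flux `Π_q[u] = ∫ S_q[u] · S_q[(u · ∇) u] dx`, where `G` is the weak gradient of `u`.
For an even `χ` the truncations of real functions are real, so the integral is real; `re` only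
changes its type. -/
def energyFlux (χ : Plane → ℝ) (q : ℕ) (u : Torus2 → Plane)
    (G : Torus2 → Matrix (Fin 2) (Fin 2) ℝ) : ℝ :=
  (∫ x, ∑ i, lpTruncation χ q (fun y => u y i) x * lpTruncation χ q (advection u G i) x
    ∂torusMeasure).re

end

noncomputable section

namespace IntermittentFlow

open UnitAddTorus ComplexConjugate

/-! The field is a lacunary sum of trigonometric polynomials ("blocks"). Each block conserves its
own energy, but cutting it at a suitable dyadic frequency exposes an internal energy exchange of
size at least `π / 16`, however high the block lies. The field does not depend on `χ`.

One block. Let `M = h³` be the lattice spacing, `s = g³` the cluster scale and `D` the amplitude.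
The stream function is `D` times the sum over six centres `z` of the wave of frequency `8 M s z`,
multiplied by the square of the Dirichlet kernel of `[-s, s]²` evaluated at `M x`. This is a
periodic array of bumps of width `1 / (M s)`, concentrated on a fraction `s⁻²` of the torus. Up to
constants the velocity is bounded by `g / h` in sup norm and by `1 / (h g²)` in `L²`. Interpolation
gives `1 / (h g) = (M s) ^ (-1/3)` in `L³`, which is the Besov bound (`memBesovTop_flow`). The
gradient is bounded by `h² g⁴` in sup norm and by `h² g⁻²` in `L¹` (`integral_norm_grad_le`), hence
by `h² g ^ (4 - 6/p)` in `L^p`. The power of `g` is negative exactly for `p < 3/2`, and `g = h ^ (k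
+ 3)` then beats `h²` for every such `p` (`BlockBounds.memLp`). The same bounds make the products of
velocities and gradients summable in `L¹` (`integral_norm_vel_mul_grad_le`).

Flux. The centres are the triad `(3,0)`, `(3,9)`, `(-6,-9)` and its reflection. With `2 ^ q = 64 M
s` the cut-off is 1 on the clusters at `±(3,0)` and 0 on the other four. Without truncation the
exchange cancels (`sum_interaction_eq_zero`); after truncation all remaining terms have one sign and
add up to a fixed amount (`transfer_lower_bound`).

Separation. Frequencies of a block are multiples of its `M`, which is at least 512 times the
frequency scale of every earlier block. Three frequencies with zero sum therefore lie in one block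
(`triad_same_block`). At the scale of block `k`, lower blocks are untouched and contribute zero,
higher blocks are cut off, and only block `k` is left (`energyFlux_eq`). -/

/-- Frequencies of functions on the torus. -/
abbrev Freq : Type := Fin 2 → ℤ

/-! ### Trigonometric polynomials -/

theorem integral_mFourier (α : Freq) :
    ∫ x, mFourier α x ∂torusMeasure = if α = 0 then 1 else 0 := by
  have h := orthonormal_iff_ite.mp (orthonormal_mFourier (d := Fin 2)) 0 α
  simp only [ContinuousMap.inner_toLp, mFourier_zero] at h
  have h2 : ∫ x, mFourier α x ∂torusMeasure = if (0 : Freq) = α then 1 else 0 := by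
    rw [← h]
    refine integral_congr_ae (ae_of_all _ fun x => ?_)
    simp
  rw [h2]
  simp [eq_comm]

/-- The trigonometric polynomial with frequencies in `s` and coefficients `c`. -/
def trigPoly (s : Finset Freq) (c : Freq → ℂ) (x : Torus2) : ℂ :=
  ∑ α ∈ s, c α * mFourier α x

theorem continuous_trigPoly (s : Finset Freq) (c : Freq → ℂ) : Continuous (trigPoly s c) := by
  unfold trigPoly; fun_prop

theorem norm_mFourier_apply (α : Freq) (x : Torus2) : ‖mFourier α x‖ = 1 := by
  simp only [mFourier, fourier_apply, ContinuousMap.coe_mk, norm_prod, Circle.norm_coe,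
      Finset.prod_const_one]

theorem norm_trigPoly_le (s : Finset Freq) (c : Freq → ℂ) (x : Torus2) :
    ‖trigPoly s c x‖ ≤ ∑ α ∈ s, ‖c α‖ := by
  refine (norm_sum_le _ _).trans (Finset.sum_le_sum fun α _ => ?_)
  rw [norm_mul, norm_mFourier_apply, mul_one]

theorem integrable_of_continuous {E : Type*} [NormedAddCommGroup E]
    {f : Torus2 → E} (hf : Continuous f) : Integrable f torusMeasure := by
  rw [← integrableOn_univ]
  exact hf.continuousOn.integrableOn_compact isCompact_univ

theorem mFourierCoeff_eq (f : Torus2 → ℂ) (β : Freq) :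
    mFourierCoeff f β = ∫ x, mFourier (-β) x * f x ∂torusMeasure := rfl

theorem integral_mFourier_mul_trigPoly (s : Finset Freq) (c : Freq → ℂ) (β : Freq) :
    ∫ x, mFourier β x * trigPoly s c x ∂torusMeasure = if -β ∈ s then c (-β) else 0 := by
  have : ∀ x, mFourier β x * trigPoly s c x = ∑ α ∈ s, c α * mFourier (β + α) x := by
    intro x
    rw [trigPoly, Finset.mul_sum]
    refine Finset.sum_congr rfl fun α _ => ?_
    rw [mFourier_add]; ring
  simp_rw [this]
  rw [integral_finsetSum _ fun α _ => integrable_of_continuous (by fun_prop)]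
  simp_rw [integral_const_mul, integral_mFourier]
  rw [← Finset.sum_ite_eq s (-β) c]
  refine Finset.sum_congr rfl fun α _ => ?_
  by_cases h : -β = α
  · simp [← h]
  · have : β + α ≠ 0 := fun h' => h (neg_eq_of_add_eq_zero_right h')
    simp [h, this]

theorem integral_norm_trigPoly_sq (s : Finset Freq) (c : Freq → ℂ) :
    ∫ x, ‖trigPoly s c x‖ ^ 2 ∂torusMeasure = ∑ α ∈ s, ‖c α‖ ^ 2 := by
  have h : ∀ x, ((‖trigPoly s c x‖ ^ 2 : ℝ) : ℂ) =
      ∑ α ∈ s, conj (c α) * (mFourier (-α) x * trigPoly s c x) := by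
    intro x
    push_cast
    rw [← Complex.conj_mul', trigPoly, map_sum, Finset.sum_mul]
    refine Finset.sum_congr rfl fun α _ => ?_
    rw [map_mul, mFourier_neg, mul_assoc]
  have h2 : ((∫ x, ‖trigPoly s c x‖ ^ 2 ∂torusMeasure : ℝ) : ℂ) =
      ((∑ α ∈ s, ‖c α‖ ^ 2 : ℝ) : ℂ) := by
    rw [← integral_complex_ofReal]
    simp_rw [h]
    have hc := continuous_trigPoly s c
    rw [integral_finsetSum _ fun α _ => integrable_of_continuous (by fun_prop)]
    simp_rw [integral_const_mul, integral_mFourier_mul_trigPoly]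
    push_cast
    refine Finset.sum_congr rfl fun α hα => ?_
    rw [neg_neg, if_pos hα, Complex.conj_mul']
  exact_mod_cast h2

/-- Cauchy–Schwarz, from the weighted arithmetic–geometric inequality; the weights are tuned to `a`
and `b` so that each half contributes `a * b / 2`. -/
theorem integral_norm_mul_le {f g : Torus2 → ℂ} (hf : Continuous f) (hg : Continuous g) {a b : ℝ}
    (ha : 0 < a) (hb : 0 < b) (hfa : ∫ x, ‖f x‖ ^ 2 ∂torusMeasure ≤ a ^ 2)
    (hgb : ∫ x, ‖g x‖ ^ 2 ∂torusMeasure ≤ b ^ 2) :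
    ∫ x, ‖f x * g x‖ ∂torusMeasure ≤ a * b := by
  have hpt : ∀ x, ‖f x * g x‖ ≤ (b / (2 * a)) * ‖f x‖ ^ 2 + (a / (2 * b)) * ‖g x‖ ^ 2 := by
    intro x
    rw [norm_mul]
    have : (b / (2 * a)) * ‖f x‖ ^ 2 + (a / (2 * b)) * ‖g x‖ ^ 2 - ‖f x‖ * ‖g x‖ =
        (b * ‖f x‖ - a * ‖g x‖) ^ 2 / (2 * a * b) := by field_simp; ring
    have h2 : 0 ≤ (b * ‖f x‖ - a * ‖g x‖) ^ 2 / (2 * a * b) := by positivity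
    linarith
  have h1 : Integrable (fun x => (b / (2 * a)) * ‖f x‖ ^ 2) torusMeasure :=
    integrable_of_continuous (by fun_prop)
  have h2 : Integrable (fun x => (a / (2 * b)) * ‖g x‖ ^ 2) torusMeasure :=
    integrable_of_continuous (by fun_prop)
  calc ∫ x, ‖f x * g x‖ ∂torusMeasure
      ≤ ∫ x, ((b / (2 * a)) * ‖f x‖ ^ 2 + (a / (2 * b)) * ‖g x‖ ^ 2) ∂torusMeasure :=
        integral_mono (integrable_of_continuous (by fun_prop)) (h1.add h2) hpt
    _ = (b / (2 * a)) * ∫ x, ‖f x‖ ^ 2 ∂torusMeasure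
        + (a / (2 * b)) * ∫ x, ‖g x‖ ^ 2 ∂torusMeasure := by
        rw [integral_add h1 h2, integral_const_mul, integral_const_mul]
    _ ≤ (b / (2 * a)) * a ^ 2 + (a / (2 * b)) * b ^ 2 := by gcongr
    _ = a * b := by field_simp; ring

/-- Hermitian coefficients on a symmetric set of frequencies give a real function. -/
theorem ofReal_re_trigPoly {s : Finset Freq} {c : Freq → ℂ} (hs : ∀ α ∈ s, -α ∈ s)
    (hc : ∀ α, c (-α) = conj (c α)) (x : Torus2) :
    (((trigPoly s c x).re : ℝ) : ℂ) = trigPoly s c x := by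
  rw [← Complex.conj_eq_iff_re, trigPoly, map_sum]
  refine Finset.sum_nbij' (fun α => -α) (fun α => -α) hs hs (by simp) (by simp) fun α _ => ?_
  rw [map_mul, ← mFourier_neg, hc]

/-! ### Integration by parts on the torus -/

/-- The covering map of the torus by the plane. -/
def torusMk (y : Fin 2 → ℝ) : Torus2 := fun i => (y i : UnitAddCircle)

theorem isOpenQuotientMap_torusMk : IsOpenQuotientMap torusMk :=
  IsOpenQuotientMap.piMap fun _ => QuotientAddGroup.isOpenQuotientMap_mk

theorem torusMk_add_single (y : Fin 2 → ℝ) (j : Fin 2) (t : ℝ) :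
    torusMk (y + Pi.single j t) = torusMk y + Pi.single j (t : UnitAddCircle) := by
  funext i
  by_cases h : i = j
  · subst h; simp [torusMk]
  · simp [torusMk, h]

theorem hasDerivAt_lift {φ : Torus2 → ℝ} (hφ : IsTestFunction φ) (j : Fin 2) (y : Fin 2 → ℝ)
    (t : ℝ) : HasDerivAt (fun t : ℝ => φ (torusMk y + Pi.single j (t : UnitAddCircle)))
      (fderiv ℝ (fun z => φ (torusMk z)) (y + Pi.single j t) (Pi.single j 1)) t := by
  have hd : DifferentiableAt ℝ (fun z => φ (torusMk z)) (y + Pi.single j t) :=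
    (ContDiff.differentiable hφ (by simp)).differentiableAt
  have hl : HasDerivAt (fun t : ℝ => y + Pi.single j t) (Pi.single j (1 : ℝ)) t := by
    simpa using (hasDerivAt_single j t).const_add y
  have := hd.hasFDerivAt.comp_hasDerivAt t hl
  simpa only [Function.comp_def, torusMk_add_single] using! this

theorem torusPartial_torusMk {φ : Torus2 → ℝ} (hφ : IsTestFunction φ) (j : Fin 2)
    (y : Fin 2 → ℝ) : torusPartial j φ (torusMk y) =
      fderiv ℝ (fun z => φ (torusMk z)) y (Pi.single j 1) := by
  have := (hasDerivAt_lift hφ j y 0).deriv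
  simpa [torusPartial] using this

theorem continuous_testFunction {φ : Torus2 → ℝ} (hφ : IsTestFunction φ) : Continuous φ :=
  isOpenQuotientMap_torusMk.isQuotientMap.continuous_iff.2 (ContDiff.continuous hφ)

theorem continuous_torusPartial {φ : Torus2 → ℝ} (hφ : IsTestFunction φ) (j : Fin 2) :
    Continuous (torusPartial j φ) := by
  refine isOpenQuotientMap_torusMk.isQuotientMap.continuous_iff.2 ?_
  have : torusPartial j φ ∘ torusMk =
      fun y => fderiv ℝ (fun z => φ (torusMk z)) y (Pi.single j 1) := by
    funext y; exact torusPartial_torusMk hφ j y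
  rw [this]
  exact (ContDiff.continuous_fderiv hφ (by simp)).clm_apply continuous_const

theorem hasDerivAt_torus {φ : Torus2 → ℝ} (hφ : IsTestFunction φ) (j : Fin 2) (x : Torus2)
    (t : ℝ) : HasDerivAt (fun t : ℝ => φ (x + Pi.single j (t : UnitAddCircle)))
      (torusPartial j φ (x + Pi.single j (t : UnitAddCircle))) t := by
  obtain ⟨y, rfl⟩ := isOpenQuotientMap_torusMk.surjective x
  rw [← torusMk_add_single, torusPartial_torusMk hφ]
  exact hasDerivAt_lift hφ j y t

theorem hasDerivAt_mFourier (α : Freq) (j : Fin 2) (x : Torus2) (t : ℝ) :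
    HasDerivAt (fun t : ℝ => mFourier α (x + Pi.single j (t : UnitAddCircle)))
      (2 * Real.pi * Complex.I * α j * mFourier α (x + Pi.single j (t : UnitAddCircle))) t := by
  have h : ∀ t : ℝ, mFourier α (x + Pi.single j (t : UnitAddCircle)) =
      fourier (α j) (t : UnitAddCircle) * mFourier α x := by
    intro t
    have h1 : ∀ i, fourier (α i) ((x + Pi.single j (t : UnitAddCircle) : Torus2) i) =
        (if i = j then fourier (α j) (t : UnitAddCircle) else 1) * fourier (α i) (x i) := by
      intro i
      by_cases h : i = j
      · subst h
        simp [fourier_apply, smul_add, AddCircle.toCircle_add, mul_comm]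
      · simp [h]
    simp only [mFourier, ContinuousMap.coe_mk, h1, Finset.prod_mul_distrib]
    simp
  simp_rw [h]
  have := (hasDerivAt_fourier 1 (α j) t).mul_const (mFourier α x)
  refine this.congr_deriv ?_
  push_cast
  ring

/-- By translation invariance the integral of a shifted `f` is constant in the shift;
differentiating under the integral gives the claim. Applied to products, this is integration by
parts. -/
theorem integral_eq_zero_of_hasDerivAt {f f' : Torus2 → ℂ} (hfc : Continuous f)
    (hfc' : Continuous f') (j : Fin 2) (hder : ∀ (x : Torus2) (t : ℝ), HasDerivAt
      (fun t : ℝ => f (x + Pi.single j (t : UnitAddCircle)))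
      (f' (x + Pi.single j (t : UnitAddCircle))) t) :
    ∫ x, f' x ∂torusMeasure = 0 := by
  have hshift : ∀ t : ℝ, Continuous fun x : Torus2 => x + Pi.single j (t : UnitAddCircle) :=
    fun t => continuous_id.add continuous_const
  obtain ⟨C, hC⟩ := isCompact_univ.exists_bound_of_continuousOn (f := f') hfc'.continuousOn
  have hm : ∀ᶠ t : ℝ in nhds 0, AEStronglyMeasurable
      (fun x : Torus2 => f (x + Pi.single j (t : UnitAddCircle))) torusMeasure :=
    Eventually.of_forall fun t => (hfc.comp (hshift t)).aestronglyMeasurable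
  have hm' : AEStronglyMeasurable
      (fun x : Torus2 => f' (x + Pi.single j ((0 : ℝ) : UnitAddCircle))) torusMeasure :=
    (hfc'.comp (hshift 0)).aestronglyMeasurable
  have key := (hasDerivAt_integral_of_dominated_loc_of_deriv_le Filter.univ_mem hm
    (integrable_of_continuous (hfc.comp (hshift 0)))
    (F' := fun (t : ℝ) (x : Torus2) => f' (x + Pi.single j (t : UnitAddCircle))) hm'
    (ae_of_all _ fun x t _ => hC _ (Set.mem_univ _)) (integrable_const C)
    (ae_of_all _ fun x t _ => hder x t)).2
  have hconst : (fun t : ℝ => ∫ x, f (x + Pi.single j (t : UnitAddCircle)) ∂torusMeasure) =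
      fun _ => ∫ x, f x ∂torusMeasure := by
    funext t
    exact integral_add_right_eq_self (μ := torusMeasure) f (Pi.single j (t : UnitAddCircle))
  rw [hconst] at key
  have hzero := (hasDerivAt_const (0 : ℝ) (∫ x, f x ∂torusMeasure)).unique key
  rw [hzero]
  refine integral_congr_ae (ae_of_all _ fun x => ?_)
  simp

theorem integral_mFourier_mul_torusPartial {φ : Torus2 → ℝ} (hφ : IsTestFunction φ) (α : Freq)
    (j : Fin 2) :
    ∫ x, mFourier α x * (torusPartial j φ x : ℂ) ∂torusMeasure =
      -∫ x, (2 * Real.pi * Complex.I * α j * mFourier α x) * (φ x : ℂ) ∂torusMeasure := by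
  have hc := continuous_testFunction hφ
  have hc' := continuous_torusPartial hφ j
  have h1 : Continuous fun x => (2 * Real.pi * Complex.I * α j * mFourier α x) * (φ x : ℂ) := by
    fun_prop
  have h2 : Continuous fun x => mFourier α x * (torusPartial j φ x : ℂ) := by fun_prop
  have h3 : Continuous fun x => mFourier α x * (φ x : ℂ) := by fun_prop
  have := integral_eq_zero_of_hasDerivAt h3 (h1.add h2) j fun x t =>
    (hasDerivAt_mFourier α j x t).mul (hasDerivAt_torus hφ j x t).ofReal_comp
  rw [integral_add' (integrable_of_continuous h1) (integrable_of_continuous h2)] at this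
  linear_combination this

/-! ### Absolutely convergent series of integrable functions -/

section Series

variable {X ι : Type*} [MeasurableSpace X] {μ : Measure X}

theorem tsum_lintegral_enorm_ne_top {E : Type*} [NormedAddCommGroup E] {f : ι → X → E}
    (hf : ∀ i, Integrable (f i) μ) (hs : Summable fun i => ∫ x, ‖f i x‖ ∂μ) :
    ∑' i, ∫⁻ x, ‖f i x‖ₑ ∂μ ≠ ⊤ := by
  have h : ∀ i, ∫⁻ x, ‖f i x‖ₑ ∂μ = ENNReal.ofReal (∫ x, ‖f i x‖ ∂μ) := fun i =>
    (ofReal_integral_norm_eq_lintegral_enorm (hf i)).symm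
  simp_rw [h]
  rw [← ENNReal.ofReal_tsum_of_nonneg (fun i => integral_nonneg fun _ => norm_nonneg _) hs]
  exact ENNReal.ofReal_ne_top

variable [Countable ι]

theorem ae_summable_norm {E : Type*} [NormedAddCommGroup E] {f : ι → X → E}
    (hf : ∀ i, Integrable (f i) μ) (hs : Summable fun i => ∫ x, ‖f i x‖ ∂μ) :
    ∀ᵐ x ∂μ, Summable fun i => ‖f i x‖ := by
  have h := tsum_lintegral_enorm_ne_top hf hs
  rw [← lintegral_tsum fun i => (hf i).1.enorm] at h
  filter_upwards [ae_lt_top' (AEMeasurable.tsum fun i => (hf i).1.enorm) h] with x hx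
  have h2 : ∑' i, ((‖f i x‖₊ : ℝ≥0) : ℝ≥0∞) ≠ ⊤ := by simpa [enorm] using hx.ne
  exact NNReal.summable_coe.2 (ENNReal.tsum_coe_ne_top_iff_summable.1 h2)

theorem integrable_tsum {f : ι → X → ℝ}
    (hf : ∀ i, Integrable (f i) μ) (hs : Summable fun i => ∫ x, ‖f i x‖ ∂μ) :
    Integrable (fun x => ∑' i, f i x) μ := by
  have hae := ae_summable_norm hf hs
  refine ⟨aestronglyMeasurable_of_tendsto_ae (u := (atTop : Filter (Finset ι)))
    (f := fun s x => ∑ i ∈ s, f i x) (fun s => ?_) ?_, ?_⟩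
  · exact Finset.aestronglyMeasurable_fun_sum s fun i _ => (hf i).1
  · filter_upwards [hae] with x hx using hx.of_norm.hasSum
  · have h := tsum_lintegral_enorm_ne_top hf hs
    rw [← lintegral_tsum fun i => (hf i).1.enorm] at h
    refine lt_of_le_of_lt (lintegral_mono_ae ?_) h.lt_top
    filter_upwards [hae] with x hx
    have h1 : ‖∑' i, f i x‖ ≤ ∑' i, ‖f i x‖ := norm_tsum_le_tsum_norm hx
    rw [← ofReal_norm]
    refine (ENNReal.ofReal_le_ofReal h1).trans ?_
    rw [ENNReal.ofReal_tsum_of_nonneg (fun _ => norm_nonneg _) hx]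
    simp_rw [ofReal_norm]
    exact le_rfl

/-- An `L¹`-convergent series may be integrated term by term against a bounded weight. -/
theorem hasSum_integral_mul_of_bounded {f : ι → X → ℝ} {w : X → ℂ}
    (hf : ∀ i, Integrable (f i) μ) (hs : Summable fun i => ∫ x, ‖f i x‖ ∂μ)
    (hw : AEStronglyMeasurable w μ) {C : ℝ} (hC : ∀ x, ‖w x‖ ≤ C) :
    HasSum (fun i => ∫ x, w x * (f i x : ℂ) ∂μ) (∫ x, w x * ((∑' i, f i x : ℝ) : ℂ) ∂μ) := by
  have hint : ∀ i, Integrable (fun x => w x * (f i x : ℂ)) μ := fun i =>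
    (hf i).ofReal.bdd_mul hw (ae_of_all _ hC)
  have hsum : Summable fun i => ∫ x, ‖w x * (f i x : ℂ)‖ ∂μ := by
    refine Summable.of_nonneg_of_le (fun i => integral_nonneg fun _ => norm_nonneg _) (fun i => ?_)
      (hs.mul_left C)
    rw [← integral_const_mul]
    refine integral_mono (hint i).norm ((hf i).norm.const_mul C) fun x => ?_
    simp only [norm_mul, Complex.norm_real]
    exact mul_le_mul_of_nonneg_right (hC x) (norm_nonneg _)
  have := hasSum_integral_of_summable_integral_norm (μ := μ) hint hsum
  simpa only [Complex.ofReal_tsum, tsum_mul_left] using this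

end Series

/-- Interpolation between `L^r` and the sup norm, from `|f|^p ≤ B^(p-r) |f|^r`. It serves with `r =
1` for the Sobolev bounds and with `r = 2`, `p = 3` for the Besov bound. -/
theorem eLpNorm_le_of_bound {X E : Type*} [MeasurableSpace X] {μ : Measure X}
    [NormedAddCommGroup E] {f : X → E} {p r B : ℝ} {A : ℝ≥0∞} (hr : 0 < r)
    (hrp : r ≤ p) (hfB : ∀ x, ‖f x‖ ≤ B) (hfA : ∫⁻ x, ‖f x‖ₑ ^ r ∂μ ≤ A) :
    eLpNorm f (ENNReal.ofReal p) μ ≤ (ENNReal.ofReal B ^ (p - r) * A) ^ (1 / p) := by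
  have hp : 0 < p := hr.trans_le hrp
  rw [eLpNorm_eq_lintegral_rpow_enorm_toReal (by simpa using hp) ENNReal.ofReal_ne_top,
    ENNReal.toReal_ofReal hp.le]
  gcongr
  calc ∫⁻ x, ‖f x‖ₑ ^ p ∂μ ≤ ∫⁻ x, ENNReal.ofReal B ^ (p - r) * ‖f x‖ₑ ^ r ∂μ := by
        refine lintegral_mono fun x => ?_
        have h1 : ‖f x‖ₑ ≤ ENNReal.ofReal B := by
          rw [← ofReal_norm]; exact ENNReal.ofReal_le_ofReal (hfB x)
        have h2 : ‖f x‖ₑ ^ p = ‖f x‖ₑ ^ (p - r) * ‖f x‖ₑ ^ r := by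
          rw [← ENNReal.rpow_add_of_nonneg _ _ (by linarith) hr.le]; simp
        rw [h2]
        gcongr
    _ = ENNReal.ofReal B ^ (p - r) * ∫⁻ x, ‖f x‖ₑ ^ r ∂μ := by
        rw [lintegral_const_mul' _ _ (ENNReal.rpow_ne_top_of_nonneg (by linarith)
          ENNReal.ofReal_ne_top)]
    _ ≤ _ := by gcongr

/-- Summability in `L¹` provides the pointwise limit; Fatou carries the triangle inequality for
partial sums in `L^p` over to it. -/
theorem memLp_tsum {X : Type*} [MeasurableSpace X] {μ : Measure X} {f : ℕ → X → ℝ}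
    (hf : ∀ i, Integrable (f i) μ) (hs : Summable fun i => ∫ x, ‖f i x‖ ∂μ) {p : ℝ≥0∞}
    (hp : 1 ≤ p) (hLp : ∑' i, eLpNorm (f i) p μ ≠ ⊤) : MemLp (fun x => ∑' i, f i x) p μ := by
  refine ⟨(integrable_tsum hf hs).1, ?_⟩
  have hlim : ∀ᵐ x ∂μ, Tendsto (fun n => (∑ i ∈ Finset.range n, f i) x) atTop
      (nhds (∑' i, f i x)) := by
    filter_upwards [ae_summable_norm hf hs] with x hx
    simpa [Finset.sum_apply] using hx.of_norm.hasSum.tendsto_sum_nat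
  refine lt_of_le_of_lt (Lp.eLpNorm_lim_le_liminf_eLpNorm (fun n =>
    Finset.aestronglyMeasurable_sum _ fun i _ => (hf i).1) _ hlim) ?_
  refine lt_of_le_of_lt (liminf_le_of_le (by isBoundedDefault) (a := ∑' i, eLpNorm (f i) p μ)
    fun b hb => ?_) hLp.lt_top
  obtain ⟨n, hn⟩ := hb.exists
  exact hn.trans ((eLpNorm_sum_le (fun i _ => (hf i).1) hp).trans (ENNReal.sum_le_tsum _))

/-- The product of two `L¹`-convergent series whose products are summable in `L¹`. -/
theorem ae_tsum_mul_tsum {X : Type*} [MeasurableSpace X] {μ : Measure X} {f g : ℕ → X → ℝ}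
    (hf : ∀ i, Integrable (f i) μ) (hfs : Summable fun i => ∫ x, ‖f i x‖ ∂μ)
    (hg : ∀ i, Integrable (g i) μ) (hgs : Summable fun i => ∫ x, ‖g i x‖ ∂μ) :
    ∀ᵐ x ∂μ, (∑' i, f i x) * ∑' i, g i x = ∑' i : ℕ × ℕ, f i.1 x * g i.2 x := by
  filter_upwards [ae_summable_norm hf hfs, ae_summable_norm hg hgs] with x h1 h2
  exact tsum_mul_tsum_of_summable_norm h1 h2

/-! ### Blocks of frequencies -/

/-- The centres of the six clusters of a block: a triad and its reflection. -/
def centers : Finset Freq := {![3, 0], ![-3, 0], ![3, 9], ![-3, -9], ![-6, -9], ![6, 9]}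

/-- The square of frequencies `[-s, s]²`. -/
def box (s : ℕ) : Finset Freq := Finset.Icc (fun _ => -(s : ℤ)) (fun _ => (s : ℤ))

/-- Index set of the frequencies of a block, with multiplicity. -/
def blockIndex (s : ℕ) : Finset (Freq × Freq × Freq) := centers ×ˢ box s ×ˢ box s

/-- The frequency at offset `β` from the centre `z`, for cluster scale `s` and lattice spacing
`M`. -/
def node (M s : ℕ) (z β : Freq) : Freq := fun i => M * (8 * s * z i + β i)

/-- The frequency attached to an index. -/
def blockFreq (M s : ℕ) (t : Freq × Freq × Freq) : Freq := node M s t.1 (t.2.1 + t.2.2)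

/-- The frequencies of a block. -/
def block (M s : ℕ) : Finset Freq := (blockIndex s).image (blockFreq M s)

/-- The number of representations of a frequency in a block. -/
def multiplicity (M s : ℕ) (α : Freq) : ℕ :=
  ((blockIndex s).filter fun t => blockFreq M s t = α).card

theorem mem_box {s : ℕ} {β : Freq} : β ∈ box s ↔ ∀ i, |β i| ≤ s := by
  simp only [box, Finset.mem_Icc, Pi.le_def, abs_le]
  exact ⟨fun h i => ⟨h.1 i, h.2 i⟩, fun h => ⟨fun i => (h i).1, fun i => (h i).2⟩⟩

theorem card_box (s : ℕ) : (box s).card = (2 * s + 1) ^ 2 := by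
  rw [box, Pi.card_Icc]
  simp only [Int.card_Icc, Finset.prod_const, Finset.card_univ, Fintype.card_fin]
  congr 1
  omega

theorem card_centers : centers.card = 6 := by decide

theorem neg_mem_centers {z : Freq} (hz : z ∈ centers) : -z ∈ centers := by
  revert z; decide

theorem neg_mem_box {s : ℕ} {β : Freq} (h : β ∈ box s) : -β ∈ box s := by
  rw [mem_box] at *; simpa using h

theorem add_mem_box {s t : ℕ} {β γ : Freq} (h : β ∈ box s) (h' : γ ∈ box t) :
    β + γ ∈ box (s + t) := by
  rw [mem_box] at *
  intro i
  push_cast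
  exact (abs_add_le _ _).trans (add_le_add (h i) (h' i))

theorem node_neg (M s : ℕ) (z β : Freq) : node M s (-z) (-β) = -node M s z β := by
  funext i; simp only [node, Pi.neg_apply]; ring

theorem exists_of_mem_block {M s : ℕ} {α : Freq} (h : α ∈ block M s) :
    ∃ z ∈ centers, ∃ β ∈ box (2 * s), α = node M s z β := by
  simp only [block, blockIndex, Finset.mem_image, Finset.mem_product] at h
  obtain ⟨⟨z, j, l⟩, ⟨hz, hj, hl⟩, rfl⟩ := h
  exact ⟨z, hz, j + l, by rw [two_mul]; exact add_mem_box hj hl, rfl⟩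

theorem neg_mem_blockIndex {s : ℕ} {t : Freq × Freq × Freq} (h : t ∈ blockIndex s) :
    -t ∈ blockIndex s := by
  simp only [blockIndex, Finset.mem_product] at *
  exact ⟨neg_mem_centers h.1, neg_mem_box h.2.1, neg_mem_box h.2.2⟩

theorem blockFreq_neg (M s : ℕ) (t : Freq × Freq × Freq) :
    blockFreq M s (-t) = -blockFreq M s t := by
  rw [blockFreq, blockFreq, ← node_neg]
  congr 1
  simp [add_comm]

theorem neg_mem_block {M s : ℕ} {α : Freq} (h : α ∈ block M s) : -α ∈ block M s := by
  simp only [block, Finset.mem_image] at *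
  obtain ⟨t, ht, rfl⟩ := h
  exact ⟨-t, neg_mem_blockIndex ht, blockFreq_neg M s t⟩

theorem multiplicity_neg (M s : ℕ) (α : Freq) : multiplicity M s (-α) = multiplicity M s α := by
  refine Finset.card_nbij' (fun t => -t) (fun t => -t) ?_ ?_
    (fun t _ => neg_neg t) (fun t _ => neg_neg t)
  · intro t ht
    simp only [Finset.coe_filter, Set.mem_ofPred_eq, blockFreq_neg] at *
    exact ⟨neg_mem_blockIndex ht.1, by rw [ht.2, neg_neg]⟩
  · intro t ht
    simp only [Finset.coe_filter, Set.mem_ofPred_eq, blockFreq_neg] at *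
    exact ⟨neg_mem_blockIndex ht.1, by rw [ht.2]⟩

theorem multiplicity_eq_zero {M s : ℕ} {α : Freq} (h : α ∉ block M s) : multiplicity M s α = 0 := by
  rw [multiplicity, Finset.card_eq_zero, Finset.filter_eq_empty_iff]
  intro t ht h'
  exact h (Finset.mem_image.2 ⟨t, ht, h'⟩)

/-- Weighting by multiplicity turns a sum over a block into a free sum over centre and two offsets,
which factors into products of exponential sums. -/
theorem sum_block {E : Type*} [AddCommMonoid E] (M s : ℕ) (f : Freq → E) :
    ∑ α ∈ block M s, multiplicity M s α • f α = ∑ t ∈ blockIndex s, f (blockFreq M s t) :=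
  (Finset.sum_comp f (blockFreq M s)).symm

/-- Centre coordinates are at most 9 and offsets at most `2 * s`, so the constant is `8 * 9 + 2`. -/
theorem abs_le_of_mem_block {M s : ℕ} {α : Freq} (h : α ∈ block M s) (i : Fin 2) :
    |α i| ≤ 74 * (M * s : ℕ) := by
  obtain ⟨z, hz, β, hβ, rfl⟩ := exists_of_mem_block h
  have h1 : ∀ z ∈ centers, ∀ i, |z i| ≤ 9 := by decide
  have h2 := h1 z hz i
  have h3 := mem_box.1 hβ i
  simp only [node, abs_mul, Nat.abs_cast]
  push_cast at h3 ⊢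
  have h4 : |8 * (s : ℤ) * z i + β i| ≤ 74 * s := by
    refine (abs_add_le _ _).trans ?_
    rw [abs_mul, abs_mul, Nat.abs_cast]
    norm_num
    nlinarith
  calc (M : ℤ) * |8 * (s : ℤ) * z i + β i| ≤ M * (74 * s) := by gcongr
    _ = _ := by ring

/-- The first coordinate of a centre is `±3` or `±6`, whence `8 * 3 - 2`. The second coordinate
vanishes at `±(3,0)`, so only the first is bounded below. -/
theorem le_abs_of_mem_block {M s : ℕ} {α : Freq} (h : α ∈ block M s) :
    22 * ((M * s : ℕ) : ℤ) ≤ |α 0| := by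
  obtain ⟨z, hz, β, hβ, rfl⟩ := exists_of_mem_block h
  have h1 : ∀ z ∈ centers, 3 ≤ |z 0| := by decide
  have h2 := h1 z hz
  have h3 := mem_box.1 hβ 0
  simp only [node, abs_mul, Nat.abs_cast]
  push_cast at h3 ⊢
  have h4 : 22 * s ≤ |8 * (s : ℤ) * z 0 + β 0| := by
    have h5 := abs_sub_abs_le_abs_add (8 * (s : ℤ) * z 0) (β 0)
    rw [abs_mul, abs_mul, Nat.abs_cast] at h5
    norm_num at h5
    nlinarith
  calc 22 * ((M : ℤ) * s) = M * (22 * s) := by ring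
    _ ≤ M * |8 * (s : ℤ) * z 0 + β 0| := by gcongr

theorem dvd_of_mem_block {M s : ℕ} {α : Freq} (h : α ∈ block M s) (i : Fin 2) : (M : ℤ) ∣ α i := by
  obtain ⟨z, hz, β, hβ, rfl⟩ := exists_of_mem_block h
  exact dvd_mul_right _ _

theorem node_injective {M s : ℕ} (hM : 0 < M) (z : Freq) : Function.Injective (node M s z) := by
  intro β γ h
  funext i
  have := congrFun h i
  simp only [node] at this
  have h2 := mul_left_cancel₀ (by exact_mod_cast hM.ne') this
  linarith

/-- The centre and the first offset determine the second offset, so there are at most `6 * (2 * s +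
1) ^ 2` representations. -/
theorem multiplicity_le {M s : ℕ} (hM : 0 < M) (hs : 0 < s) (α : Freq) :
    multiplicity M s α ≤ 54 * s ^ 2 := by
  have : multiplicity M s α ≤ (centers ×ˢ box s).card := by
    refine Finset.card_le_card_of_injOn (fun t => (t.1, t.2.1)) ?_ ?_
    · rintro ⟨z, j, l⟩ ht
      simp only [blockIndex, Finset.coe_filter, Finset.mem_product, Set.mem_ofPred_eq] at ht
      simp [ht.1.1, ht.1.2.1]
    · rintro ⟨z, j, l⟩ ht ⟨z', j', l'⟩ ht' h
      simp only [Prod.mk.injEq] at h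
      obtain ⟨rfl, rfl⟩ := h
      simp only [Finset.coe_filter, Set.mem_ofPred_eq] at ht ht'
      have := node_injective hM _ (ht.2.trans ht'.2.symm)
      simpa using this
  refine this.trans ?_
  rw [Finset.card_product, card_centers, card_box]
  nlinarith

theorem card_block_le {M s : ℕ} (hs : 0 < s) : (block M s).card ≤ 150 * s ^ 2 := by
  have : block M s ⊆ (centers ×ˢ box (2 * s)).image fun p => node M s p.1 p.2 := by
    intro α hα
    obtain ⟨z, hz, β, hβ, rfl⟩ := exists_of_mem_block hα
    exact Finset.mem_image.2 ⟨(z, β), Finset.mem_product.2 ⟨hz, hβ⟩, rfl⟩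
  refine (Finset.card_le_card this).trans (Finset.card_image_le.trans ?_)
  rw [Finset.card_product, card_centers, card_box]
  nlinarith

/-- In the inner half-width box of offsets the multiplicity is comparable with its maximum: every
`j` in `box (2 * τ)` gives the splitting `β = j + (β - j)`. -/
theorem le_multiplicity {M τ : ℕ} {z β : Freq} (hz : z ∈ centers) (hβ : β ∈ box (2 * τ)) :
    (4 * τ) ^ 2 ≤ multiplicity M (4 * τ) (node M (4 * τ) z β) := by
  have : (box (2 * τ)).card ≤ multiplicity M (4 * τ) (node M (4 * τ) z β) := by
    refine Finset.card_le_card_of_injOn (fun j => (z, j, β - j)) ?_ ?_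
    · intro j hj
      have hj' : j ∈ box (2 * τ) := hj
      have h1 : β - j ∈ box (4 * τ) := by
        rw [sub_eq_add_neg, show 4 * τ = 2 * τ + 2 * τ by ring]
        exact add_mem_box hβ (neg_mem_box hj')
      have h2 : j ∈ box (4 * τ) := by
        rw [mem_box] at *
        intro i; have := hj' i; push_cast at *; linarith [Nat.cast_nonneg (α := ℤ) τ]
      refine Finset.mem_coe.2 (Finset.mem_filter.2 ⟨?_, ?_⟩)
      · exact Finset.mem_product.2 ⟨hz, Finset.mem_product.2 ⟨h2, h1⟩⟩
      · simp [blockFreq]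
    · intro j _ j' _ h
      simpa using congrArg (fun t : Freq × Freq × Freq => t.2.1) h
  refine le_trans ?_ this
  rw [card_box]
  gcongr
  omega

/-! ### The velocity field of a stream function -/

/-- The rotated frequency. -/
def perp (α : Freq) : Fin 2 → ℝ := ![(α 1 : ℝ), -(α 0 : ℝ)]

/-- Fourier coefficients of the velocity field with stream coefficients `ψ`. -/
def velCoeff (ψ : Freq → ℝ) (i : Fin 2) (α : Freq) : ℂ := Complex.I * ((perp α i * ψ α : ℝ) : ℂ)

/-- Fourier coefficients of the gradient of that velocity field. -/
def gradCoeff (ψ : Freq → ℝ) (i j : Fin 2) (α : Freq) : ℂ :=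
  2 * Real.pi * Complex.I * α j * velCoeff ψ i α

theorem gradCoeff_eq (ψ : Freq → ℝ) (i j : Fin 2) (α : Freq) :
    gradCoeff ψ i j α = ((-(2 * Real.pi) * (α j * perp α i * ψ α) : ℝ) : ℂ) := by
  rw [gradCoeff, velCoeff]
  push_cast
  linear_combination (2 * Real.pi * α j * (perp α i * ψ α : ℂ)) * Complex.I_mul_I

theorem perp_neg (α : Freq) (i : Fin 2) : perp (-α) i = -perp α i := by
  fin_cases i <;> simp [perp]

theorem velCoeff_neg {ψ : Freq → ℝ} (hψ : ∀ α, ψ (-α) = ψ α) (i : Fin 2) (α : Freq) :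
    velCoeff ψ i (-α) = conj (velCoeff ψ i α) := by
  rw [velCoeff, velCoeff, perp_neg, hψ, map_mul, Complex.conj_I, Complex.conj_ofReal]
  push_cast
  ring

theorem gradCoeff_neg {ψ : Freq → ℝ} (hψ : ∀ α, ψ (-α) = ψ α) (i j : Fin 2) (α : Freq) :
    gradCoeff ψ i j (-α) = conj (gradCoeff ψ i j α) := by
  rw [gradCoeff_eq, gradCoeff_eq, perp_neg, hψ, Complex.conj_ofReal]
  simp

theorem sum_gradCoeff_diag (ψ : Freq → ℝ) (α : Freq) : ∑ j, gradCoeff ψ j j α = 0 := by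
  simp only [gradCoeff_eq, Fin.sum_univ_two, perp]
  push_cast
  simp
  ring

theorem abs_perp_le {α : Freq} {R : ℝ} (h : ∀ i, |(α i : ℝ)| ≤ R) (i : Fin 2) : |perp α i| ≤ R := by
  fin_cases i
  · simpa [perp] using h 1
  · simpa [perp] using h 0

theorem norm_velCoeff_le {ψ : Freq → ℝ} {α : Freq} {R W : ℝ} (h : ∀ i, |(α i : ℝ)| ≤ R)
    (hW : |ψ α| ≤ W) (i : Fin 2) : ‖velCoeff ψ i α‖ ≤ R * W := by
  rw [velCoeff, norm_mul, Complex.norm_I, one_mul, Complex.norm_real, Real.norm_eq_abs, abs_mul]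
  exact mul_le_mul (abs_perp_le h i) hW (abs_nonneg _) ((abs_nonneg _).trans (h 0))

theorem norm_gradCoeff_le {ψ : Freq → ℝ} {α : Freq} {R W : ℝ} (h : ∀ i, |(α i : ℝ)| ≤ R)
    (hW : |ψ α| ≤ W) (i j : Fin 2) : ‖gradCoeff ψ i j α‖ ≤ 2 * Real.pi * (R * (R * W)) := by
  have hR : 0 ≤ R := (abs_nonneg _).trans (h 0)
  rw [gradCoeff_eq, Complex.norm_real, Real.norm_eq_abs, abs_mul, abs_mul, abs_mul, abs_neg,
    abs_of_pos Real.two_pi_pos, mul_assoc |(α j : ℝ)|]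
  have h1 := abs_perp_le h i
  have h2 := h j
  have hW0 : 0 ≤ W := (abs_nonneg _).trans hW
  gcongr

/-! ### Triad interactions and conservation of energy -/

/-- The cross product of two frequencies. -/
def cross (b c : Freq) : ℤ := b 0 * c 1 - b 1 * c 0

/-- The square of the length of a frequency. -/
def normSq (b : Freq) : ℤ := b 0 ^ 2 + b 1 ^ 2

/-- The dot product of two frequencies. -/
def dot (b c : Freq) : ℤ := b 0 * c 0 + b 1 * c 1

/-- The interaction of the modes `b` and `c` tested against the mode `-(b + c)`, which is weighted
by `κ`. -/
def interaction (κ ψ₁ ψ₂ ψ₃ : Freq → ℝ) (b c : Freq) : ℝ :=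
  2 * Real.pi * (cross b c * (dot b c + normSq c)) *
    (κ (b + c) * ψ₁ (b + c) * ψ₂ b * ψ₃ c)

/-- The two sums decouple: over `j` one gets `perp b · c = -cross b c`, over `i` one gets `perp a ·
perp c = a · c = -(dot b c + normSq c)`. -/
theorem sum_coeff_mul (ψ₁ ψ₂ ψ₃ : Freq → ℝ) (a b c : Freq) (h : a = -(b + c)) :
    ∑ i, ∑ j, velCoeff ψ₁ i a * (velCoeff ψ₂ j b * gradCoeff ψ₃ i j c) =
      ((2 * Real.pi * (cross b c * (dot b c + normSq c)) * (ψ₁ a * ψ₂ b * ψ₃ c) : ℝ) : ℂ) := by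
  subst h
  simp only [gradCoeff_eq, velCoeff, Fin.sum_univ_two, perp, cross, dot, normSq, Pi.neg_apply,
    Pi.add_apply]
  push_cast
  simp
  ring_nf
  simp only [Complex.I_sq]
  ring

/-- The trilinear form `∫ v · (u · ∇) w` of three fields with finitely many modes. -/
theorem integral_trilinear {κ ψ₁ ψ₂ ψ₃ : Freq → ℝ} {s₁ s₂ s₃ : Finset Freq}
    (hs₁ : ∀ α ∉ s₁, ψ₁ α = 0) (hψ₁ : ∀ α, ψ₁ (-α) = ψ₁ α) (hκ : ∀ α, κ (-α) = κ α) :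
    ∑ i, ∑ j, ∫ x, trigPoly s₁ (fun α => κ α * velCoeff ψ₁ i α) x *
      (trigPoly s₂ (velCoeff ψ₂ j) x * trigPoly s₃ (gradCoeff ψ₃ i j) x) ∂torusMeasure =
    ((∑ b ∈ s₂, ∑ c ∈ s₃, interaction κ ψ₁ ψ₂ ψ₃ b c : ℝ) : ℂ) := by
  have key : ∀ i j, ∫ x, trigPoly s₁ (fun α => κ α * velCoeff ψ₁ i α) x *
      (trigPoly s₂ (velCoeff ψ₂ j) x * trigPoly s₃ (gradCoeff ψ₃ i j) x) ∂torusMeasure =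
      ∑ b ∈ s₂, ∑ c ∈ s₃, κ (b + c) * (velCoeff ψ₁ i (-(b + c)) *
        (velCoeff ψ₂ j b * gradCoeff ψ₃ i j c)) := by
    intro i j
    have hpt : ∀ x, trigPoly s₁ (fun α => κ α * velCoeff ψ₁ i α) x *
        (trigPoly s₂ (velCoeff ψ₂ j) x * trigPoly s₃ (gradCoeff ψ₃ i j) x) =
        ∑ b ∈ s₂, ∑ c ∈ s₃, (velCoeff ψ₂ j b * gradCoeff ψ₃ i j c) * (mFourier (b + c) x *
          trigPoly s₁ (fun α => κ α * velCoeff ψ₁ i α) x) := by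
      intro x
      rw [trigPoly.eq_def s₂, trigPoly.eq_def s₃, Finset.sum_mul_sum, Finset.mul_sum]
      refine Finset.sum_congr rfl fun b _ => ?_
      rw [Finset.mul_sum]
      refine Finset.sum_congr rfl fun c _ => ?_
      rw [mFourier_add]; ring
    simp_rw [hpt]
    have hc := continuous_trigPoly s₁ (fun α => κ α * velCoeff ψ₁ i α)
    rw [integral_finsetSum _ fun b _ => integrable_of_continuous (by fun_prop)]
    refine Finset.sum_congr rfl fun b _ => ?_
    rw [integral_finsetSum _ fun c _ => integrable_of_continuous (by fun_prop)]
    refine Finset.sum_congr rfl fun c _ => ?_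
    rw [integral_const_mul, integral_mFourier_mul_trigPoly]
    split_ifs with h
    · rw [hκ]; ring
    · have : velCoeff ψ₁ i (-(b + c)) = 0 := by
        rw [velCoeff, hs₁ _ h]; simp
      rw [this]; simp
  simp_rw [key]
  have hswap : ∀ F : Fin 2 → Fin 2 → Freq → Freq → ℂ,
      ∑ i, ∑ j, ∑ b ∈ s₂, ∑ c ∈ s₃, F i j b c = ∑ b ∈ s₂, ∑ c ∈ s₃, ∑ i, ∑ j, F i j b c := by
    intro F
    simp only [Fin.sum_univ_two, Finset.sum_add_distrib]
  rw [hswap]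
  push_cast
  refine Finset.sum_congr rfl fun b _ => Finset.sum_congr rfl fun c _ => ?_
  have hsum := sum_coeff_mul ψ₁ ψ₂ ψ₃ _ b c rfl
  simp only [← Finset.mul_sum] at hsum ⊢
  rw [hsum, hψ₁, interaction]
  push_cast
  ring

theorem cross_swap (b c : Freq) : cross c b = -cross b c := by simp only [cross]; ring

/-- The symmetric form of the interactions inside one set of modes. -/
theorem sum_interaction_eq (κ ψ : Freq → ℝ) (s : Finset Freq) :
    ∑ b ∈ s, ∑ c ∈ s, interaction κ ψ ψ ψ b c =
      ∑ b ∈ s, ∑ c ∈ s, Real.pi * ((cross b c * (normSq c - normSq b) : ℤ) : ℝ) *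
        (κ (b + c) * ψ (b + c) * ψ b * ψ c) := by
  have h : ∑ b ∈ s, ∑ c ∈ s, interaction κ ψ ψ ψ b c =
      ∑ b ∈ s, ∑ c ∈ s, interaction κ ψ ψ ψ c b := Finset.sum_comm
  -- Exchanging `b` and `c` reverses the sign of `cross`, so the `dot` terms cancel and only the
  -- difference of squared lengths remains.
  have h2 : ∑ b ∈ s, ∑ c ∈ s, (interaction κ ψ ψ ψ b c + interaction κ ψ ψ ψ c b) =
      ∑ b ∈ s, ∑ c ∈ s, 2 * (Real.pi * ((cross b c * (normSq c - normSq b) : ℤ) : ℝ) *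
        (κ (b + c) * ψ (b + c) * ψ b * ψ c)) := by
    refine Finset.sum_congr rfl fun b _ => Finset.sum_congr rfl fun c _ => ?_
    simp only [interaction, add_comm c b, cross_swap b c]
    simp only [dot]
    push_cast
    ring
  simp only [Finset.sum_add_distrib, ← h, ← Finset.mul_sum] at h2
  linarith

/-- Without truncation there is no net transfer of energy. -/
theorem sum_interaction_eq_zero {κ ψ : Freq → ℝ} {s : Finset Freq} (hs : ∀ α ∉ s, ψ α = 0)
    (hneg : ∀ α ∈ s, -α ∈ s) (hψ : ∀ α, ψ (-α) = ψ α) (hκ : ∀ α ∈ s, κ α = 1) :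
    ∑ b ∈ s, ∑ c ∈ s, interaction κ ψ ψ ψ b c = 0 := by
  rw [sum_interaction_eq]
  -- The sum is rewritten over triads `a + b + c = 0` as a difference of two triple sums, one
  -- carrying `normSq c` and one carrying `normSq b`.
  set f : Freq → Freq → Freq → ℝ := fun a b c =>
    if a + b + c = 0 then Real.pi * (cross b c * normSq c) * (ψ a * ψ b * ψ c) else 0 with hf
  set g : Freq → Freq → Freq → ℝ := fun a b c =>
    if a + b + c = 0 then Real.pi * (cross b c * normSq b) * (ψ a * ψ b * ψ c) else 0 with hg
  have h1 : ∀ b ∈ s, ∀ c ∈ s, Real.pi * ((cross b c * (normSq c - normSq b) : ℤ) : ℝ) *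
      (κ (b + c) * ψ (b + c) * ψ b * ψ c) = ∑ a ∈ s, (f a b c - g a b c) := by
    intro b _ c _
    by_cases hm : -(b + c) ∈ s
    · rw [Finset.sum_eq_single_of_mem _ hm]
      · have : -(b + c) + b + c = 0 := by abel
        have h2 : κ (b + c) = 1 := hκ _ (by simpa using hneg _ hm)
        simp only [hf, hg, this, if_true, hψ, h2]
        push_cast
        ring
      · intro a _ hne
        have : a + b + c ≠ 0 := fun h => hne (by
          rw [add_assoc] at h; exact eq_neg_of_add_eq_zero_left h)
        simp [hf, hg, this]
    · have h0 : ψ (b + c) = 0 := by rw [← hψ]; exact hs _ hm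
      rw [Finset.sum_eq_zero, h0]
      · ring
      · intro a ha
        have : a + b + c ≠ 0 := fun h => hm (by
          rw [add_assoc] at h; rwa [← eq_neg_of_add_eq_zero_left h])
        simp [hf, hg, this]
  -- On a triad with zero sum `cross` is invariant under cyclic rotation, so the two triple sums
  -- agree after renaming the variables.
  have hrot : ∀ a b c, f a b c = g b c a := by
    intro a b c
    simp only [hf, hg]
    have : b + c + a = a + b + c := by abel
    rw [this]
    split_ifs with h
    · have h3 : a = -(b + c) := by rw [add_assoc] at h; exact eq_neg_of_add_eq_zero_left h
      have h2 : cross b c = cross c a := by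
        subst h3; simp only [cross, Pi.neg_apply, Pi.add_apply]; ring
      rw [h2]; ring
    · rfl
  calc _ = ∑ b ∈ s, ∑ c ∈ s, ∑ a ∈ s, (f a b c - g a b c) :=
        Finset.sum_congr rfl fun b hb => Finset.sum_congr rfl fun c hc => h1 b hb c hc
    _ = ∑ b ∈ s, ∑ c ∈ s, ∑ a ∈ s, g b c a - ∑ b ∈ s, ∑ c ∈ s, ∑ a ∈ s, g a b c := by
        simp only [Finset.sum_sub_distrib, hrot]
    _ = 0 := by
        rw [sub_eq_zero]
        conv_rhs => rw [Finset.sum_congr rfl fun b _ => Finset.sum_comm, Finset.sum_comm]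

/-! ### The energy transfer inside one block -/

/-- Stream coefficients of a block, with amplitude `D`. -/
def stream (D : ℝ) (M s : ℕ) (α : Freq) : ℝ := D * multiplicity M s α

theorem stream_neg (D : ℝ) (M s : ℕ) (α : Freq) : stream D M s (-α) = stream D M s α := by
  rw [stream, stream, multiplicity_neg]

theorem stream_eq_zero (D : ℝ) {M s : ℕ} {α : Freq} (h : α ∉ block M s) : stream D M s α = 0 := by
  rw [stream, multiplicity_eq_zero h]; simp

theorem stream_nonneg {D : ℝ} (hD : 0 ≤ D) (M s : ℕ) (α : Freq) : 0 ≤ stream D M s α := by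
  unfold stream; positivity

theorem abs_stream_le {D : ℝ} (hD : 0 ≤ D) {M s : ℕ} (hM : 0 < M) (hs : 0 < s) (α : Freq) :
    |stream D M s α| ≤ 54 * D * s ^ 2 := by
  rw [abs_of_nonneg (stream_nonneg hD _ _ _), stream]
  have : (multiplicity M s α : ℝ) ≤ 54 * s ^ 2 := by exact_mod_cast multiplicity_le hM hs α
  nlinarith

/-! ### Sign and size of the transfer towards the axis clusters -/

theorem cross_node_ge {M s : ℕ} {β γ : Freq} (hβ : β ∈ box (2 * s)) (hγ : γ ∈ box (2 * s)) :
    ((M * s : ℕ) : ℤ) ^ 2 ≤ cross (node M s ![3, 9] β) (node M s ![-6, -9] γ) := by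
  have h0 := abs_le.1 (mem_box.1 hβ 0)
  have h1 := abs_le.1 (mem_box.1 hβ 1)
  have h2 := abs_le.1 (mem_box.1 hγ 0)
  have h3 := abs_le.1 (mem_box.1 hγ 1)
  simp only [cross, node]
  simp only [Matrix.cons_val_zero, Matrix.cons_val_one, Matrix.cons_val_fin_one]
  push_cast at *
  generalize β 0 = x at *
  generalize β 1 = y at *
  generalize γ 0 = z at *
  generalize γ 1 = w at *
  have hs : (0 : ℤ) ≤ s := by positivity
  have key : (s : ℤ) ^ 2 ≤ (8 * s * 3 + x) * (8 * s * -9 + w) - (8 * s * 9 + y) * (8 * s * -6 + z) := by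
    have e1 : -(4 * (s : ℤ) ^ 2) ≤ x * w := by nlinarith
    have e2 : y * z ≤ 4 * (s : ℤ) ^ 2 := by nlinarith
    nlinarith [mul_nonneg hs (sub_nonneg.2 h0.2), mul_nonneg hs (sub_nonneg.2 h1.1),
      mul_nonneg hs (sub_nonneg.2 h2.2), mul_nonneg hs (sub_nonneg.2 h3.1)]
  have := mul_le_mul_of_nonneg_left key (sq_nonneg (M : ℤ))
  linarith

/-- For the bare centres both `cross` and the difference of squared lengths equal 27, that is `27 *
64 * s ^ 2` after scaling; the offsets change these values by much less, here and in
`cross_node_ge`. -/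
theorem normSq_node_sub_ge {M s : ℕ} {β γ : Freq} (hβ : β ∈ box (2 * s)) (hγ : γ ∈ box (2 * s)) :
    ((M * s : ℕ) : ℤ) ^ 2 ≤ normSq (node M s ![-6, -9] γ) - normSq (node M s ![3, 9] β) := by
  have h0 := abs_le.1 (mem_box.1 hβ 0)
  have h1 := abs_le.1 (mem_box.1 hβ 1)
  have h2 := abs_le.1 (mem_box.1 hγ 0)
  have h3 := abs_le.1 (mem_box.1 hγ 1)
  simp only [normSq, node]
  simp only [Matrix.cons_val_zero, Matrix.cons_val_one, Matrix.cons_val_fin_one]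
  push_cast at *
  generalize β 0 = x at *
  generalize β 1 = y at *
  generalize γ 0 = z at *
  generalize γ 1 = w at *
  have hs : (0 : ℤ) ≤ s := by positivity
  have key : (s : ℤ) ^ 2 ≤ (8 * s * -6 + z) ^ 2 + (8 * s * -9 + w) ^ 2 -
      ((8 * s * 3 + x) ^ 2 + (8 * s * 9 + y) ^ 2) := by
    have e1 : x ^ 2 ≤ 4 * (s : ℤ) ^ 2 := by nlinarith
    have e2 : y ^ 2 ≤ 4 * (s : ℤ) ^ 2 := by nlinarith
    nlinarith [mul_nonneg hs (sub_nonneg.2 h0.2), mul_nonneg hs (sub_nonneg.2 h1.2),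
      mul_nonneg hs (sub_nonneg.2 h2.2), mul_nonneg hs (sub_nonneg.2 h3.2), sq_nonneg z,
      sq_nonneg w]
  have := mul_le_mul_of_nonneg_left key (sq_nonneg (M : ℤ))
  linarith

/-- Three offsets add up to at most `6 * s`, less than the spacing `8 * s` of the centres, so a
relation between nodes forces the same relation between centres. -/
theorem center_add_eq {M s : ℕ} (hM : 0 < M) (hs : 0 < s) {z₁ z₂ z₃ β₁ β₂ β₃ : Freq}
    (h₁ : β₁ ∈ box (2 * s)) (h₂ : β₂ ∈ box (2 * s)) (h₃ : β₃ ∈ box (2 * s))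
    (h : node M s z₁ β₁ + node M s z₂ β₂ = node M s z₃ β₃) : z₁ + z₂ = z₃ := by
  funext i
  have hi := congrFun h i
  simp only [node, Pi.add_apply, ← mul_add] at hi
  have hi' := mul_left_cancel₀ (by exact_mod_cast hM.ne') hi
  have a1 := abs_le.1 (mem_box.1 h₁ i)
  have a2 := abs_le.1 (mem_box.1 h₂ i)
  have a3 := abs_le.1 (mem_box.1 h₃ i)
  push_cast at a1 a2 a3
  have hs' : (0 : ℤ) < s := by exact_mod_cast hs
  have e : 8 * (s : ℤ) * (z₁ i + z₂ i - z₃ i) = β₃ i - β₁ i - β₂ i := by linarith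
  have e1 : z₁ i + z₂ i - z₃ i < 1 := by
    by_contra hc; push Not at hc; nlinarith
  have e2 : -1 < z₁ i + z₂ i - z₃ i := by
    by_contra hc; push Not at hc; nlinarith
  simp only [Pi.add_apply]
  omega

theorem cross_neg (b c : Freq) : cross (-b) (-c) = cross b c := by
  simp only [cross, Pi.neg_apply]; ring

theorem normSq_neg (b : Freq) : normSq (-b) = normSq b := by
  simp only [normSq, Pi.neg_apply]; ring

theorem transfer_nonneg_of_node {M s : ℕ} {β γ : Freq} (hβ : β ∈ box (2 * s))
    (hγ : γ ∈ box (2 * s)) {b c : Freq} (hb : b = node M s ![3, 9] β)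
    (hc : c = node M s ![-6, -9] γ) : 0 ≤ cross b c * (normSq c - normSq b) := by
  subst hb hc
  exact mul_nonneg ((sq_nonneg _).trans (cross_node_ge hβ hγ))
    ((sq_nonneg _).trans (normSq_node_sub_ge hβ hγ))

theorem transfer_swap (b c : Freq) :
    cross c b * (normSq b - normSq c) = cross b c * (normSq c - normSq b) := by
  rw [cross_swap]; ring

/-- Two centres add up to `±(3,0)` only as the other two legs of the triad, up to order and
reflection. The transfer is invariant under both, so one case decides the sign. -/
theorem transfer_nonneg {M s : ℕ} (hM : 0 < M) (hs : 0 < s) {b c : Freq} (hb : b ∈ block M s)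
    (hc : c ∈ block M s) {z γ : Freq} (hz : z = ![3, 0] ∨ z = ![-3, 0])
    (hγ : γ ∈ box (2 * s)) (hbc : b + c = node M s z γ) :
    0 ≤ cross b c * (normSq c - normSq b) := by
  obtain ⟨z₁, hz₁, β₁, hβ₁, rfl⟩ := exists_of_mem_block hb
  obtain ⟨z₂, hz₂, β₂, hβ₂, rfl⟩ := exists_of_mem_block hc
  have hsum := center_add_eq hM hs hβ₁ hβ₂ hγ hbc
  have key : ∀ z₁ ∈ centers, ∀ z₂ ∈ centers, (z₁ + z₂ = ![3, 0] ∨ z₁ + z₂ = ![-3, 0]) →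
      (z₁ = ![3, 9] ∧ z₂ = ![-6, -9]) ∨ (z₁ = ![-6, -9] ∧ z₂ = ![3, 9]) ∨
      (-z₁ = ![3, 9] ∧ -z₂ = ![-6, -9]) ∨ (-z₁ = ![-6, -9] ∧ -z₂ = ![3, 9]) := by decide
  rcases key z₁ hz₁ z₂ hz₂ (by rwa [hsum]) with ⟨h1, h2⟩ | ⟨h1, h2⟩ | ⟨h1, h2⟩ | ⟨h1, h2⟩
  · exact transfer_nonneg_of_node hβ₁ hβ₂ (by rw [h1]) (by rw [h2])
  · rw [← transfer_swap]
    exact transfer_nonneg_of_node hβ₂ hβ₁ (by rw [h2]) (by rw [h1])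
  · rw [← cross_neg, ← normSq_neg (node M s z₂ β₂), ← normSq_neg (node M s z₁ β₁)]
    exact transfer_nonneg_of_node (neg_mem_box hβ₁) (neg_mem_box hβ₂)
      (by rw [← node_neg, h1]) (by rw [← node_neg, h2])
  · rw [← cross_neg, ← normSq_neg (node M s z₂ β₂), ← normSq_neg (node M s z₁ β₁),
      ← transfer_swap]
    exact transfer_nonneg_of_node (neg_mem_box hβ₂) (neg_mem_box hβ₁)
      (by rw [← node_neg, h2]) (by rw [← node_neg, h1])

theorem mem_block_of_stream_ne_zero {D : ℝ} {M s : ℕ} {α : Freq} (h : stream D M s α ≠ 0) :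
    α ∈ block M s := by
  by_contra hc; exact h (stream_eq_zero D hc)

theorem box_mono {s t : ℕ} (h : s ≤ t) : box s ⊆ box t := by
  intro β hβ
  rw [mem_box] at *
  exact fun i => (hβ i).trans (by exact_mod_cast h)

theorem node_mem_block {M s : ℕ} {z β : Freq} (hz : z ∈ centers) (hβ : β ∈ box s) :
    node M s z β ∈ block M s := by
  refine Finset.mem_image.2 ⟨(z, β, 0), ?_, by simp [blockFreq]⟩
  refine Finset.mem_product.2 ⟨hz, Finset.mem_product.2 ⟨hβ, ?_⟩⟩
  rw [mem_box]; simp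

/-- The truncation that keeps the two clusters on the axis transfers a definite amount of
energy. -/
theorem transfer_lower_bound {D : ℝ} (hD : 0 ≤ D) {M τ : ℕ} (hM : 0 < M) (hτ : 0 < τ)
    {κ : Freq → ℝ}
    (hκ1 : ∀ z, z = ![3, 0] ∨ z = ![-3, 0] → ∀ β ∈ box (2 * (4 * τ)), κ (node M (4 * τ) z β) = 1)
    (hκ0 : ∀ z ∈ centers, ¬(z = ![3, 0] ∨ z = ![-3, 0]) → ∀ β ∈ box (2 * (4 * τ)),
      κ (node M (4 * τ) z β) = 0) :
    Real.pi * (M * (4 * τ)) ^ 4 * (D * (4 * τ) ^ 2) ^ 3 * (2 * τ) ^ 4 ≤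
      ∑ b ∈ block M (4 * τ), ∑ c ∈ block M (4 * τ), interaction κ (stream D M (4 * τ))
        (stream D M (4 * τ)) (stream D M (4 * τ)) b c := by
  set s := 4 * τ with hs
  have hs0 : 0 < s := by omega
  set ψ := stream D M s with hψ
  have hψ0 : ∀ α, 0 ≤ ψ α := stream_nonneg hD M s
  rw [sum_interaction_eq, ← Finset.sum_product']
  set F : Freq × Freq → ℝ := fun p =>
    Real.pi * ((cross p.1 p.2 * (normSq p.2 - normSq p.1) : ℤ) : ℝ) *
        (κ (p.1 + p.2) * ψ (p.1 + p.2) * ψ p.1 * ψ p.2) with hF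
  have hnonneg : ∀ p ∈ block M s ×ˢ block M s, 0 ≤ F p := by
    rintro ⟨b, c⟩ hp
    obtain ⟨hb, hc⟩ := Finset.mem_product.1 hp
    by_cases h0 : ψ (b + c) = 0
    · simp [hF, h0]
    obtain ⟨z, hz, γ, hγ, hbc⟩ := exists_of_mem_block (mem_block_of_stream_ne_zero h0)
    by_cases hzA : z = ![3, 0] ∨ z = ![-3, 0]
    · have h1 := transfer_nonneg hM hs0 hb hc hzA hγ hbc
      have h2 : (0 : ℝ) ≤ ((cross b c * (normSq c - normSq b) : ℤ) : ℝ) := by exact_mod_cast h1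
      have h3 : κ (b + c) = 1 := by rw [hbc]; exact hκ1 z hzA γ hγ
      simp only [hF, h3, one_mul]
      exact mul_nonneg (mul_nonneg Real.pi_pos.le h2)
        (mul_nonneg (mul_nonneg (hψ0 _) (hψ0 _)) (hψ0 _))
    · have h3 : κ (b + c) = 0 := by rw [hbc]; exact hκ0 z hz hzA γ hγ
      simp [hF, h3]
  -- All terms being nonnegative, only pairs near `(3,9)` and `(-6,-9)` with offsets in `box τ` are
  -- kept. Their sum lies near `(-3,0)` with offset in `box (2 * τ)`, so all three stream
  -- coefficients are at least `D * (4 * τ) ^ 2`.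
  set g : Freq × Freq → Freq × Freq := fun p =>
    (node M s ![3, 9] p.1, node M s ![-6, -9] p.2) with hg
  have hginj : Function.Injective g := by
    rintro ⟨b, c⟩ ⟨b', c'⟩ h
    simp only [hg, Prod.mk.injEq] at h
    rw [node_injective hM _ h.1, node_injective hM _ h.2]
  have hτs : τ ≤ s := by omega
  have hsub : (box τ ×ˢ box τ).image g ⊆ block M s ×ˢ block M s := by
    intro p hp
    obtain ⟨⟨β, γ⟩, hq, rfl⟩ := Finset.mem_image.1 hp
    obtain ⟨hb, hc⟩ := Finset.mem_product.1 hq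
    exact Finset.mem_product.2 ⟨node_mem_block (by decide) (box_mono hτs hb),
      node_mem_block (by decide) (box_mono hτs hc)⟩
  refine le_trans ?_ (Finset.sum_le_sum_of_subset_of_nonneg hsub fun p hp _ => hnonneg p hp)
  rw [Finset.sum_image fun p _ q _ h => hginj h]
  have hlow : ∀ β : Freq, ∀ z ∈ centers, β ∈ box (2 * τ) → D * (4 * τ : ℝ) ^ 2 ≤
      ψ (node M s z β) := by
    intro β z hz hβ
    rw [hψ, stream]
    have : (((4 * τ) ^ 2 : ℕ) : ℝ) ≤ multiplicity M s (node M s z β) := by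
      exact_mod_cast le_multiplicity hz hβ
    push_cast at this
    gcongr
  have hterm : ∀ p ∈ box τ ×ˢ box τ,
      Real.pi * (M * (4 * τ)) ^ 4 * (D * (4 * τ) ^ 2) ^ 3 ≤ F (g p) := by
    rintro ⟨β, γ⟩ hp
    obtain ⟨hβ, hγ⟩ := Finset.mem_product.1 hp
    simp only at hβ hγ
    have hsum : node M s ![3, 9] β + node M s ![-6, -9] γ = node M s ![-3, 0] (β + γ) := by
      funext i
      simp only [node, Pi.add_apply]
      fin_cases i <;> simp <;> ring
    have hβγ : β + γ ∈ box (2 * τ) := by rw [two_mul]; exact add_mem_box hβ hγ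
    have hκ : κ (node M s ![-3, 0] (β + γ)) = 1 :=
      hκ1 _ (Or.inr rfl) _ (box_mono (by omega) hβγ)
    have hc1 : ((M : ℝ) * (4 * τ)) ^ 2 ≤ cross (node M s ![3, 9] β) (node M s ![-6, -9] γ) := by
      have := cross_node_ge (M := M) (s := s) (box_mono (by omega) hβ) (box_mono (by omega) hγ)
      rw [hs] at this ⊢
      exact_mod_cast this
    have hc2 : ((M : ℝ) * (4 * τ)) ^ 2 ≤
        ((normSq (node M s ![-6, -9] γ) - normSq (node M s ![3, 9] β) : ℤ) : ℝ) := by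
      have := normSq_node_sub_ge (M := M) (s := s) (box_mono (by omega) hβ) (box_mono (by omega) hγ)
      rw [hs] at this ⊢
      exact_mod_cast this
    have l1 := hlow _ ![-3, 0] (by decide) hβγ
    have l2 := hlow β ![3, 9] (by decide) (box_mono (by omega) hβ)
    have l3 := hlow γ ![-6, -9] (by decide) (box_mono (by omega) hγ)
    simp only [hF, hg, hsum, hκ, one_mul]
    rw [Int.cast_mul]
    have hX : ((M : ℝ) * (4 * τ)) ^ 4 ≤ cross (node M s ![3, 9] β) (node M s ![-6, -9] γ) *
        ((normSq (node M s ![-6, -9] γ) - normSq (node M s ![3, 9] β) : ℤ) : ℝ) := by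
      calc ((M : ℝ) * (4 * τ)) ^ 4 = (M * (4 * τ)) ^ 2 * (M * (4 * τ)) ^ 2 := by ring
        _ ≤ _ := mul_le_mul hc1 hc2 (sq_nonneg _) ((sq_nonneg _).trans hc1)
    have hY : (D * (4 * τ : ℝ) ^ 2) ^ 3 ≤ ψ (node M s ![-3, 0] (β + γ)) *
        ψ (node M s ![3, 9] β) * ψ (node M s ![-6, -9] γ) := by
      calc (D * (4 * τ : ℝ) ^ 2) ^ 3 = (D * (4 * τ) ^ 2) * (D * (4 * τ) ^ 2) *
          (D * (4 * τ) ^ 2) := by ring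
        _ ≤ _ := mul_le_mul (mul_le_mul l1 l2 (by positivity) (hψ0 _)) l3 (by positivity)
            (mul_nonneg (hψ0 _) (hψ0 _))
    exact mul_le_mul (mul_le_mul_of_nonneg_left hX Real.pi_pos.le) hY (by positivity)
      (mul_nonneg Real.pi_pos.le ((by positivity : (0 : ℝ) ≤ _).trans hX))
  refine le_trans ?_ (Finset.card_nsmul_le_sum _ _ _ hterm)
  rw [Finset.card_product, card_box, nsmul_eq_mul, mul_comm]
  have : ((2 : ℝ) * τ) ^ 4 ≤ (((2 * τ + 1) ^ 2 * (2 * τ + 1) ^ 2 : ℕ) : ℝ) := by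
    rw [← pow_add]
    push_cast
    gcongr
    linarith
  gcongr

/-! ### Bounds for one block -/

theorem integral_norm_sum_sq_le {s : Finset Freq} {ν : Freq → Freq} (hν : Function.Injective ν)
    {p : Freq → ℂ} {a : ℝ} (hp : ∀ j ∈ s, ‖p j‖ ≤ a) :
    ∫ x, ‖∑ j ∈ s, p j * mFourier (ν j) x‖ ^ 2 ∂torusMeasure ≤ s.card * a ^ 2 := by
  have h : ∀ x, ∑ j ∈ s, p j * mFourier (ν j) x =
      trigPoly (s.image ν) (fun α => p (Function.invFun ν α)) x := by
    intro x
    rw [trigPoly, Finset.sum_image fun _ _ _ _ h => hν h]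
    refine Finset.sum_congr rfl fun j _ => ?_
    rw [Function.leftInverse_invFun hν]
  simp_rw [h]
  rw [integral_norm_trigPoly_sq, Finset.sum_image fun _ _ _ _ h => hν h]
  simp_rw [Function.leftInverse_invFun hν _]
  rw [← nsmul_eq_mul]
  refine Finset.sum_le_card_nsmul _ _ _ fun j hj => ?_
  have := hp j hj
  gcongr

theorem integral_norm_sum_mul_sum_le {s : ℕ} {ν ν' : Freq → Freq} (hν : Function.Injective ν)
    (hν' : Function.Injective ν') {p q : Freq → ℂ} {a b : ℝ} (ha : 0 < a) (hb : 0 < b)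
    (hp : ∀ j ∈ box s, ‖p j‖ ≤ a) (hq : ∀ j ∈ box s, ‖q j‖ ≤ b) :
    ∫ x, ‖(∑ j ∈ box s, p j * mFourier (ν j) x) * ∑ j ∈ box s, q j * mFourier (ν' j) x‖
      ∂torusMeasure ≤ (2 * s + 1) ^ 2 * (a * b) := by
  have h1 := integral_norm_sum_sq_le hν hp
  have h2 := integral_norm_sum_sq_le hν' hq
  rw [card_box] at h1 h2
  push_cast at h1 h2
  rw [← mul_pow] at h1 h2
  refine (integral_norm_mul_le (by fun_prop) (by fun_prop) (by positivity) (by positivity)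
    h1 h2).trans (le_of_eq ?_)
  ring

theorem abs_node_le {M s : ℕ} {z β : Freq} (hz : z ∈ centers) (hβ : β ∈ box s) (i : Fin 2) :
    |(node M s z β i : ℝ)| ≤ 74 * (M * s) := by
  have := abs_le_of_mem_block (node_mem_block (M := M) hz hβ) i
  exact_mod_cast this

theorem perp_add (α β : Freq) (i : Fin 2) : perp (α + β) i = perp α i + perp β i := by
  fin_cases i
  · simp [perp]
  · simp [perp]; ring

/-- The concentration estimate. Frequencies split as `P k + Q l` with independent offsets `k`, `l`,
and the symbol `α j * perp α i` is quadratic in them. So the gradient is a sum of products of two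
exponential sums, and Cauchy–Schwarz with orthogonality bounds each product in `L¹`. Bounding the
`L¹` norm by the `L²` norm of the whole gradient would lose the smallness. -/
theorem integral_norm_grad_le {D : ℝ} (hD : 0 ≤ D) {M s : ℕ} (hM : 0 < M) (hs : 0 < s)
    (i j : Fin 2) :
    ∫ x, ‖trigPoly (block M s) (gradCoeff (stream D M s) i j) x‖ ∂torusMeasure ≤
      2 * Real.pi * D * (216 * s ^ 2 * (74 * (M * s)) ^ 2) := by
  set R : ℝ := 74 * (M * s) with hR
  have hR0 : 0 < R := by positivity
  set Q : Freq → Freq := fun l i => M * l i with hQ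
  have hQinj : Function.Injective Q := by
    intro l l' h
    funext i
    exact mul_left_cancel₀ (by exact_mod_cast hM.ne') (congrFun h i)
  have hPQ : ∀ z k l, blockFreq M s (z, k, l) = node M s z k + Q l := by
    intro z k l
    funext i
    simp only [blockFreq, node, Pi.add_apply, hQ]; ring
  set S : (Freq → ℂ) → (Freq → Freq) → Torus2 → ℂ := fun p ν x =>
    ∑ k ∈ box s, p k * mFourier (ν k) x with hS
  -- The four terms of `(P + Q) j * perp (P + Q) i`; with six centres they account for the factor 24
  -- below, and `2 * s + 1 ≤ 3 * s` turns it into 216.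
  set T : Freq → Fin 4 → Torus2 → ℂ := fun z => ![
    fun x => S (fun k => ((node M s z k j : ℝ) * perp (node M s z k) i : ℝ)) (node M s z) x *
      S (fun _ => (1 : ℝ)) Q x,
    fun x => S (fun k => (node M s z k j : ℝ)) (node M s z) x *
      S (fun l => (perp (Q l) i : ℝ)) Q x,
    fun x => S (fun k => (perp (node M s z k) i : ℝ)) (node M s z) x *
      S (fun l => (Q l j : ℝ)) Q x,
    fun x => S (fun _ => (1 : ℝ)) (node M s z) x *
      S (fun l => ((Q l j : ℝ) * perp (Q l) i : ℝ)) Q x] with hT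
  have hexp : ∀ x, trigPoly (block M s) (gradCoeff (stream D M s) i j) x =
      ((-(2 * Real.pi) * D : ℝ) : ℂ) * ∑ z ∈ centers, ∑ n, T z n x := by
    intro x
    have h1 : trigPoly (block M s) (gradCoeff (stream D M s) i j) x =
        ((-(2 * Real.pi) * D : ℝ) : ℂ) * ∑ α ∈ block M s, multiplicity M s α •
          (((α j * perp α i : ℝ) : ℂ) * mFourier α x) := by
      rw [trigPoly, Finset.mul_sum]
      refine Finset.sum_congr rfl fun α _ => ?_
      rw [gradCoeff_eq, stream, nsmul_eq_mul]
      push_cast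
      ring
    rw [h1, sum_block, blockIndex, Finset.sum_product]
    congr 1
    refine Finset.sum_congr rfl fun z _ => ?_
    rw [Finset.sum_product]
    simp only [hT, Fin.sum_univ_four, Matrix.cons_val, hS, Finset.sum_mul_sum,
      ← Finset.sum_add_distrib]
    refine Finset.sum_congr rfl fun k _ => Finset.sum_congr rfl fun l _ => ?_
    rw [hPQ, mFourier_add, perp_add, Pi.add_apply]
    push_cast
    ring
  have hQb : ∀ l ∈ box s, ∀ i, |(Q l i : ℝ)| ≤ R := by
    intro l hl i
    have := mem_box.1 hl i
    simp only [hQ]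
    push_cast
    rw [abs_mul, Nat.abs_cast, hR]
    have h2 : |(l i : ℝ)| ≤ s := by exact_mod_cast this
    have h3 : (0 : ℝ) ≤ M * s := by positivity
    calc (M : ℝ) * |(l i : ℝ)| ≤ M * s := by gcongr
      _ ≤ _ := by linarith
  have hTc : ∀ z n, Continuous (T z n) := by
    have hSc : ∀ p ν, Continuous (S p ν) := fun p ν => by simp only [hS]; fun_prop
    intro z n
    fin_cases n <;> exact (hSc _ _).mul (hSc _ _)
  have hTb : ∀ z ∈ centers, ∀ n, ∫ x, ‖T z n x‖ ∂torusMeasure ≤ (2 * s + 1) ^ 2 * R ^ 2 := by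
    intro z hz n
    have hP : ∀ k ∈ box s, ∀ i, |(node M s z k i : ℝ)| ≤ R := fun k hk i => abs_node_le hz hk i
    have hPi := node_injective (s := s) hM z
    have n1 : ∀ k ∈ box s, ‖((1 : ℝ) : ℂ)‖ ≤ 1 := fun k _ => by simp
    have nR : ∀ r : ℝ, |r| ≤ R → ‖(r : ℂ)‖ ≤ R := fun r hr => by
      rwa [Complex.norm_real, Real.norm_eq_abs]
    have nRR : ∀ r r' : ℝ, |r| ≤ R → |r'| ≤ R → ‖((r * r' : ℝ) : ℂ)‖ ≤ R ^ 2 := by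
      intro r r' h h'
      rw [Complex.norm_real, Real.norm_eq_abs, abs_mul, sq]
      gcongr
    fin_cases n
    · refine (integral_norm_sum_mul_sum_le hPi hQinj (by positivity : 0 < R ^ 2) one_pos
        (fun k hk => nRR _ _ (hP k hk j) (abs_perp_le (hP k hk) i)) n1).trans (le_of_eq ?_)
      ring
    · refine (integral_norm_sum_mul_sum_le hPi hQinj hR0 hR0
        (fun k hk => nR _ (hP k hk j)) (fun k hk => nR _ (abs_perp_le (hQb k hk) i))).trans
        (le_of_eq ?_)
      ring
    · refine (integral_norm_sum_mul_sum_le hPi hQinj hR0 hR0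
        (fun k hk => nR _ (abs_perp_le (hP k hk) i)) (fun k hk => nR _ (hQb k hk j))).trans
        (le_of_eq ?_)
      ring
    · refine (integral_norm_sum_mul_sum_le hPi hQinj one_pos (by positivity : 0 < R ^ 2)
        n1 (fun k hk => nRR _ _ (hQb k hk j) (abs_perp_le (hQb k hk) i))).trans (le_of_eq ?_)
      ring
  calc ∫ x, ‖trigPoly (block M s) (gradCoeff (stream D M s) i j) x‖ ∂torusMeasure
      ≤ ∫ x, 2 * Real.pi * D * ∑ z ∈ centers, ∑ n, ‖T z n x‖ ∂torusMeasure := by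
        refine integral_mono (integrable_of_continuous (continuous_trigPoly _ _).norm)
          (integrable_of_continuous (by fun_prop)) fun x => ?_
        simp only [hexp]
        rw [norm_mul, Complex.norm_real, Real.norm_eq_abs, abs_mul, abs_neg,
          abs_of_pos Real.two_pi_pos, abs_of_nonneg hD]
        gcongr
        exact (norm_sum_le _ _).trans (Finset.sum_le_sum fun z _ => norm_sum_le _ _)
    _ = 2 * Real.pi * D * ∑ z ∈ centers, ∑ n, ∫ x, ‖T z n x‖ ∂torusMeasure := by
        rw [integral_const_mul, integral_finsetSum _ fun z _ =>
          integrable_of_continuous (by fun_prop)]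
        congr 1
        refine Finset.sum_congr rfl fun z _ => ?_
        rw [integral_finsetSum _ fun n _ => integrable_of_continuous (hTc z n).norm]
    _ ≤ 2 * Real.pi * D * ∑ z ∈ centers, ∑ n : Fin 4, (2 * s + 1 : ℝ) ^ 2 * R ^ 2 := by
        have := Real.pi_pos
        gcongr with z hz n _
        exact hTb z hz n
    _ = 2 * Real.pi * D * (24 * (2 * s + 1) ^ 2 * R ^ 2) := by
        simp only [Finset.sum_const, card_centers, Finset.card_univ, Fintype.card_fin]
        simp only [nsmul_eq_mul]
        push_cast
        ring
    _ ≤ 2 * Real.pi * D * (216 * s ^ 2 * R ^ 2) := by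
        have := Real.pi_pos
        have hs1 : (1 : ℝ) ≤ s := by exact_mod_cast hs
        have : 24 * (2 * s + 1 : ℝ) ^ 2 ≤ 216 * s ^ 2 := by nlinarith
        gcongr

/-! ### The sequence of scales -/

/-- Cube root of the lattice spacing of the `k`-th block. -/
def hSeq : ℕ → ℕ
  | 0 => 8
  | k + 1 => 8 * (hSeq k * hSeq k ^ (k + 3))

/-- Cube root of the cluster scale of the `k`-th block. -/
def gSeq (k : ℕ) : ℕ := hSeq k ^ (k + 3)

theorem hSeq_succ (k : ℕ) : hSeq (k + 1) = 8 * (hSeq k * gSeq k) := rfl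

theorem eight_pow_le_hSeq (k : ℕ) : 8 ^ (k + 1) ≤ hSeq k := by
  induction k with
  | zero => simp [hSeq]
  | succ k ih =>
    rw [hSeq_succ, pow_succ, mul_comm]
    have : 1 ≤ gSeq k := Nat.one_le_pow _ _ ((Nat.pow_pos (by norm_num)).trans_le ih)
    gcongr
    nlinarith

theorem hSeq_pos (k : ℕ) : 0 < hSeq k := (Nat.pow_pos (by norm_num)).trans_le (eight_pow_le_hSeq k)

theorem eight_le_hSeq (k : ℕ) : 8 ≤ hSeq k :=
  (Nat.le_self_pow (by omega) 8).trans (eight_pow_le_hSeq k)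

theorem gSeq_pos (k : ℕ) : 0 < gSeq k := Nat.pow_pos (hSeq_pos k)

theorem hSeq_pow_le_gSeq (k : ℕ) : hSeq k ^ 3 ≤ gSeq k :=
  Nat.pow_le_pow_right (hSeq_pos k) (by omega)

theorem hSeq_mono : Monotone hSeq := by
  refine monotone_nat_of_le_succ fun k => ?_
  rw [hSeq_succ]
  have := gSeq_pos k
  nlinarith [hSeq_pos k]

theorem gSeq_mono : Monotone gSeq := by
  intro j k h
  exact (Nat.pow_le_pow_left (hSeq_mono h) _).trans
    (Nat.pow_le_pow_right (hSeq_pos k) (by omega))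

theorem eight_mul_le_hSeq {j k : ℕ} (h : j < k) : 8 * (hSeq j * gSeq j) ≤ hSeq k := by
  rw [← hSeq_succ]; exact hSeq_mono h

/-- Makes `64 * freqScale k` exactly a dyadic scale `2 ^ q`, and the cluster scale divisible by 4.
-/
theorem exists_hSeq_eq_two_pow (k : ℕ) : ∃ e, hSeq k = 2 ^ e := by
  induction k with
  | zero => exact ⟨3, rfl⟩
  | succ k ih =>
    obtain ⟨e, he⟩ := ih
    refine ⟨3 + (e + e * (k + 3)), ?_⟩
    rw [hSeq_succ, gSeq, he, ← pow_mul, pow_add, pow_add]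
    norm_num

/-- Lattice spacing of the `k`-th block. -/
def spacing (k : ℕ) : ℕ := hSeq k ^ 3

/-- Cluster scale of the `k`-th block. -/
def scale (k : ℕ) : ℕ := gSeq k ^ 3

/-- Length scale of the frequencies of the `k`-th block. -/
def freqScale (k : ℕ) : ℕ := spacing k * scale k

theorem spacing_pos (k : ℕ) : 0 < spacing k := Nat.pow_pos (hSeq_pos k)

theorem scale_pos (k : ℕ) : 0 < scale k := Nat.pow_pos (gSeq_pos k)

theorem freqScale_pos (k : ℕ) : 0 < freqScale k := Nat.mul_pos (spacing_pos k) (scale_pos k)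

/-- The gap is between earlier frequencies and the new lattice spacing, not merely the new
frequencies; the divisibility argument of `IsMode.not_lt_and_le` needs this. The 512 is the cube of
the 8 in the recursion. -/
theorem freqScale_le_spacing {j k : ℕ} (h : j < k) : 512 * freqScale j ≤ spacing k := by
  calc 512 * freqScale j = (8 * (hSeq j * gSeq j)) ^ 3 := by
        rw [freqScale, spacing, scale]; ring
    _ ≤ hSeq k ^ 3 := Nat.pow_le_pow_left (eight_mul_le_hSeq h) 3

theorem freqScale_le_freqScale {j k : ℕ} (h : j < k) : 512 * freqScale j ≤ freqScale k :=
  (freqScale_le_spacing h).trans (Nat.le_mul_of_pos_right _ (scale_pos k))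

/-- Amplitude of the `k`-th block. -/
def amplitude (k : ℕ) : ℝ := ((hSeq k : ℝ) ^ 4 * (gSeq k : ℝ) ^ 14)⁻¹

theorem amplitude_nonneg (k : ℕ) : 0 ≤ amplitude k := by unfold amplitude; positivity

/-- Frequencies of the `k`-th block. -/
def freqs (k : ℕ) : Finset Freq := block (spacing k) (scale k)

/-- Stream coefficients of the `k`-th block. -/
def psi (k : ℕ) : Freq → ℝ := stream (amplitude k) (spacing k) (scale k)

theorem psi_neg (k : ℕ) (α : Freq) : psi k (-α) = psi k α := stream_neg _ _ _ _

theorem psi_eq_zero {k : ℕ} {α : Freq} (h : α ∉ freqs k) : psi k α = 0 := stream_eq_zero _ h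

theorem neg_mem_freqs {k : ℕ} {α : Freq} (h : α ∈ freqs k) : -α ∈ freqs k := neg_mem_block h

theorem abs_le_of_mem_freqs {k : ℕ} {α : Freq} (h : α ∈ freqs k) (i : Fin 2) :
    |(α i : ℝ)| ≤ 74 * freqScale k := by
  exact_mod_cast abs_le_of_mem_block h i

/-- A velocity component of the `k`-th block. -/
def vel (k : ℕ) (i : Fin 2) (x : Torus2) : ℝ := (trigPoly (freqs k) (velCoeff (psi k) i) x).re

/-- An entry of the velocity gradient of the `k`-th block. -/
def grad (k : ℕ) (i j : Fin 2) (x : Torus2) : ℝ :=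
  (trigPoly (freqs k) (gradCoeff (psi k) i j) x).re

theorem ofReal_vel (k : ℕ) (i : Fin 2) (x : Torus2) :
    (vel k i x : ℂ) = trigPoly (freqs k) (velCoeff (psi k) i) x :=
  ofReal_re_trigPoly (fun _ => neg_mem_freqs) (velCoeff_neg (psi_neg k) i) x

theorem ofReal_grad (k : ℕ) (i j : Fin 2) (x : Torus2) :
    (grad k i j x : ℂ) = trigPoly (freqs k) (gradCoeff (psi k) i j) x :=
  ofReal_re_trigPoly (fun _ => neg_mem_freqs) (gradCoeff_neg (psi_neg k) i j) x

theorem norm_vel (k : ℕ) (i : Fin 2) (x : Torus2) :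
    ‖vel k i x‖ = ‖trigPoly (freqs k) (velCoeff (psi k) i) x‖ := by
  rw [← ofReal_vel, Complex.norm_real]

theorem norm_grad (k : ℕ) (i j : Fin 2) (x : Torus2) :
    ‖grad k i j x‖ = ‖trigPoly (freqs k) (gradCoeff (psi k) i j) x‖ := by
  rw [← ofReal_grad, Complex.norm_real]

theorem continuous_vel (k : ℕ) (i : Fin 2) : Continuous (vel k i) :=
  Complex.continuous_re.comp (continuous_trigPoly _ _)

theorem continuous_grad (k : ℕ) (i j : Fin 2) : Continuous (grad k i j) :=
  Complex.continuous_re.comp (continuous_trigPoly _ _)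

/-! ### Sup, `L²` and `L¹` sizes of the blocks in powers of `hSeq` and `gSeq` -/

theorem abs_psi_le (k : ℕ) (α : Freq) :
    |psi k α| ≤ 54 * ((hSeq k : ℝ) ^ 4 * (gSeq k : ℝ) ^ 8)⁻¹ := by
  refine (abs_stream_le (amplitude_nonneg k) (spacing_pos k) (scale_pos k) α).trans (le_of_eq ?_)
  have h1 : (hSeq k : ℝ) ≠ 0 := by exact_mod_cast (hSeq_pos k).ne'
  have h2 : (gSeq k : ℝ) ≠ 0 := by exact_mod_cast (gSeq_pos k).ne'
  rw [amplitude, scale]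
  push_cast
  field_simp

theorem card_freqs_le (k : ℕ) : ((freqs k).card : ℝ) ≤ 150 * (gSeq k : ℝ) ^ 6 := by
  have := card_block_le (M := spacing k) (scale_pos k)
  have h2 : 150 * scale k ^ 2 = 150 * gSeq k ^ 6 := by rw [scale]; ring
  rw [h2] at this
  exact_mod_cast this

theorem norm_velCoeff_psi_le {k : ℕ} {α : Freq} (h : α ∈ freqs k) (i : Fin 2) :
    ‖velCoeff (psi k) i α‖ ≤ 3996 * ((hSeq k : ℝ) * (gSeq k : ℝ) ^ 5)⁻¹ := by
  refine (norm_velCoeff_le (abs_le_of_mem_freqs h) (abs_psi_le k α) i).trans (le_of_eq ?_)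
  have h1 : (hSeq k : ℝ) ≠ 0 := by exact_mod_cast (hSeq_pos k).ne'
  have h2 : (gSeq k : ℝ) ≠ 0 := by exact_mod_cast (gSeq_pos k).ne'
  rw [freqScale, spacing, scale]
  push_cast
  field_simp
  norm_num

theorem sum_norm_velCoeff_le (k : ℕ) (i : Fin 2) :
    ∑ α ∈ freqs k, ‖velCoeff (psi k) i α‖ ≤ 599400 * ((gSeq k : ℝ) / hSeq k) := by
  have h1 : (0 : ℝ) < hSeq k := by exact_mod_cast (hSeq_pos k)
  have h2 : (0 : ℝ) < gSeq k := by exact_mod_cast (gSeq_pos k)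
  calc _ ≤ (freqs k).card • (3996 * ((hSeq k : ℝ) * (gSeq k : ℝ) ^ 5)⁻¹) :=
        Finset.sum_le_card_nsmul _ _ _ fun α h => norm_velCoeff_psi_le h i
    _ ≤ (150 * (gSeq k : ℝ) ^ 6) * (3996 * ((hSeq k : ℝ) * (gSeq k : ℝ) ^ 5)⁻¹) := by
        rw [nsmul_eq_mul]
        gcongr
        exact card_freqs_le k
    _ = _ := by field_simp; norm_num

theorem sum_norm_velCoeff_sq_le (k : ℕ) (i : Fin 2) :
    ∑ α ∈ freqs k, ‖velCoeff (psi k) i α‖ ^ 2 ≤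
      (51948 * ((hSeq k : ℝ) * (gSeq k : ℝ) ^ 2)⁻¹) ^ 2 := by
  have h1 : (0 : ℝ) < hSeq k := by exact_mod_cast (hSeq_pos k)
  have h2 : (0 : ℝ) < gSeq k := by exact_mod_cast (gSeq_pos k)
  calc _ ≤ (freqs k).card • (3996 * ((hSeq k : ℝ) * (gSeq k : ℝ) ^ 5)⁻¹) ^ 2 := by
        refine Finset.sum_le_card_nsmul _ _ _ fun α h => ?_
        have := norm_velCoeff_psi_le h i
        gcongr
    -- 150 is rounded up to `13 ^ 2` to make the bound a perfect square, with `51948 = 13 * 3996`.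
    _ ≤ (169 * (gSeq k : ℝ) ^ 6) * (3996 * ((hSeq k : ℝ) * (gSeq k : ℝ) ^ 5)⁻¹) ^ 2 := by
        rw [nsmul_eq_mul]
        gcongr
        refine (card_freqs_le k).trans ?_
        gcongr
        norm_num
    _ = _ := by field_simp; norm_num

theorem norm_vel_le (k : ℕ) (i : Fin 2) (x : Torus2) :
    ‖vel k i x‖ ≤ 10 ^ 9 * ((gSeq k : ℝ) / hSeq k) := by
  rw [norm_vel]
  refine (norm_trigPoly_le _ _ _).trans ((sum_norm_velCoeff_le k i).trans ?_)
  gcongr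
  norm_num

/-- For the velocity the `L²` norm is already small enough, so Cauchy–Schwarz against the constant 1
suffices. -/
theorem integral_norm_vel_le (k : ℕ) (i : Fin 2) :
    ∫ x, ‖vel k i x‖ ∂torusMeasure ≤ 10 ^ 9 * ((hSeq k : ℝ) * (gSeq k : ℝ) ^ 2)⁻¹ := by
  have h1 : (0 : ℝ) < hSeq k := by exact_mod_cast (hSeq_pos k)
  have h2 : (0 : ℝ) < gSeq k := by exact_mod_cast (gSeq_pos k)
  have := integral_norm_mul_le (f := trigPoly (freqs k) (velCoeff (psi k) i)) (g := fun _ => 1)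
    (continuous_trigPoly _ _) continuous_const
    (by positivity : 0 < 51948 * ((hSeq k : ℝ) * (gSeq k : ℝ) ^ 2)⁻¹) one_pos
    (by rw [integral_norm_trigPoly_sq]; exact sum_norm_velCoeff_sq_le k i) (by simp)
  simp only [mul_one] at this
  simp_rw [norm_vel]
  refine this.trans ?_
  gcongr
  norm_num

theorem norm_grad_le (k : ℕ) (i j : Fin 2) (x : Torus2) :
    ‖grad k i j x‖ ≤ 10 ^ 9 * ((hSeq k : ℝ) ^ 2 * (gSeq k : ℝ) ^ 4) := by
  have h1 : (0 : ℝ) < hSeq k := by exact_mod_cast (hSeq_pos k)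
  have h2 : (0 : ℝ) < gSeq k := by exact_mod_cast (gSeq_pos k)
  rw [norm_grad]
  refine (norm_trigPoly_le _ _ _).trans ?_
  set R : ℝ := 74 * freqScale k with hR
  set W : ℝ := 54 * ((hSeq k : ℝ) ^ 4 * (gSeq k : ℝ) ^ 8)⁻¹ with hW
  have hpi := Real.pi_pos
  calc _ ≤ (freqs k).card • (2 * Real.pi * (R * (R * W))) :=
        Finset.sum_le_card_nsmul _ _ _ fun α h =>
          norm_gradCoeff_le (abs_le_of_mem_freqs h) (abs_psi_le k α) i j
    _ ≤ (150 * (gSeq k : ℝ) ^ 6) * (2 * 3.15 * (R * (R * W))) := by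
        rw [nsmul_eq_mul]
        gcongr
        · exact card_freqs_le k
        · exact Real.pi_lt_d2.le
    _ = 279440280 * ((hSeq k : ℝ) ^ 2 * (gSeq k : ℝ) ^ 4) := by
        rw [hR, hW, freqScale, spacing, scale]
        push_cast
        field_simp
        norm_num
    _ ≤ _ := by gcongr; norm_num

/-- The gain over `norm_grad_le` is `gSeq k ^ (-6)`, the inverse square of the cluster scale, as
expected for bumps filling that fraction of the torus. -/
theorem integral_norm_grad_psi_le (k : ℕ) (i j : Fin 2) :
    ∫ x, ‖grad k i j x‖ ∂torusMeasure ≤ 10 ^ 9 * ((hSeq k : ℝ) ^ 2 * ((gSeq k : ℝ) ^ 2)⁻¹) := by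
  have h1 : (0 : ℝ) < hSeq k := by exact_mod_cast (hSeq_pos k)
  have h2 : (0 : ℝ) < gSeq k := by exact_mod_cast (gSeq_pos k)
  simp_rw [norm_grad]
  refine (integral_norm_grad_le (amplitude_nonneg k) (spacing_pos k) (scale_pos k) i j).trans ?_
  have hpi := Real.pi_pos
  have hA := amplitude_nonneg k
  calc _ ≤ 2 * 3.15 * amplitude k * (216 * (scale k : ℝ) ^ 2 * (74 * (spacing k * scale k)) ^ 2) := by
        gcongr
        exact Real.pi_lt_d2.le
    _ = 7451740.8 * ((hSeq k : ℝ) ^ 2 * ((gSeq k : ℝ) ^ 2)⁻¹) := by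
        rw [amplitude, spacing, scale]
        push_cast
        field_simp
        norm_num
    _ ≤ _ := by gcongr; norm_num

/-! ### Summability over the blocks -/

/-- The base `1 / 4` is chosen because it splits as `(1 / 2) * (1 / 2)`, which makes double sums
over blocks converge. -/
theorem inv_hSeq_le (k : ℕ) : ((hSeq k : ℝ))⁻¹ ≤ (1 / 4) ^ k := by
  rw [one_div, inv_pow]
  have : ((8 ^ (k + 1) : ℕ) : ℝ) ≤ hSeq k := by exact_mod_cast eight_pow_le_hSeq k
  push_cast at this
  have h4 : (4 : ℝ) ^ k ≤ 8 ^ (k + 1) := by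
    calc (4 : ℝ) ^ k ≤ 8 ^ k := by gcongr; norm_num
      _ ≤ _ := by gcongr <;> norm_num
  gcongr
  exact h4.trans this

theorem one_le_hSeq (k : ℕ) : (1 : ℝ) ≤ hSeq k := by exact_mod_cast hSeq_pos k

theorem hSeq_pow_le_gSeq_real (k : ℕ) : (hSeq k : ℝ) ^ 3 ≤ gSeq k := by
  exact_mod_cast hSeq_pow_le_gSeq k

theorem grad_mass_le (k : ℕ) : (hSeq k : ℝ) ^ 2 * ((gSeq k : ℝ) ^ 2)⁻¹ ≤ (hSeq k : ℝ)⁻¹ := by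
  have h1 := one_le_hSeq k
  have h0 : (0 : ℝ) < hSeq k := by linarith
  have h2 := hSeq_pow_le_gSeq_real k
  have h3 : (hSeq k : ℝ) ^ 3 ≤ (gSeq k : ℝ) ^ 2 := by
    calc (hSeq k : ℝ) ^ 3 ≤ (hSeq k : ℝ) ^ 6 := pow_le_pow_right₀ h1 (by norm_num)
      _ = ((hSeq k : ℝ) ^ 3) ^ 2 := by ring
      _ ≤ _ := by gcongr
  have h4 : (0 : ℝ) < (gSeq k : ℝ) ^ 2 := (pow_pos h0 3).trans_le h3
  rw [← div_eq_mul_inv, div_le_iff₀ h4, inv_mul_eq_div, le_div_iff₀ h0]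
  linarith

theorem summable_inv_hSeq (C : ℝ) : Summable fun k => C * (hSeq k : ℝ)⁻¹ := by
  refine Summable.mul_left C (Summable.of_nonneg_of_le (fun k => by positivity) inv_hSeq_le ?_)
  exact summable_geometric_of_lt_one (by norm_num) (by norm_num)

/-- The common bounds of the velocity and gradient components of the blocks. -/
structure BlockBounds (f : ℕ → Torus2 → ℝ) : Prop where
  continuous : ∀ k, Continuous (f k)
  norm_le : ∀ k x, ‖f k x‖ ≤ 10 ^ 9 * ((hSeq k : ℝ) ^ 2 * (gSeq k : ℝ) ^ 4)
  integral_le : ∀ k, ∫ x, ‖f k x‖ ∂torusMeasure ≤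
    10 ^ 9 * ((hSeq k : ℝ) ^ 2 * ((gSeq k : ℝ) ^ 2)⁻¹)

theorem blockBounds_grad (i j : Fin 2) : BlockBounds fun k => grad k i j :=
  ⟨fun k => continuous_grad k i j, fun k => norm_grad_le k i j,
    fun k => integral_norm_grad_psi_le k i j⟩

/-- The velocity satisfies the gradient bounds with room to spare, so one integrability argument
covers both. -/
theorem blockBounds_vel (i : Fin 2) : BlockBounds fun k => vel k i := by
  refine ⟨fun k => continuous_vel k i, fun k x => (norm_vel_le k i x).trans ?_,
    fun k => (integral_norm_vel_le k i).trans ?_⟩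
  · have h1 := one_le_hSeq k
    have h2 : (1 : ℝ) ≤ gSeq k := by exact_mod_cast gSeq_pos k
    gcongr
    calc (gSeq k : ℝ) / hSeq k ≤ gSeq k := div_le_self (by linarith) h1
      _ ≤ (gSeq k : ℝ) ^ 4 := le_self_pow₀ h2 (by norm_num)
      _ ≤ _ := le_mul_of_one_le_left (by positivity) (one_le_pow₀ h1)
  · have h1 := one_le_hSeq k
    rw [mul_inv]
    gcongr
    exact (inv_le_one_of_one_le₀ h1).trans (one_le_pow₀ h1)

namespace BlockBounds

variable {f : ℕ → Torus2 → ℝ}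

theorem integrable (hf : BlockBounds f) (k : ℕ) : Integrable (f k) torusMeasure :=
  integrable_of_continuous (hf.continuous k)

theorem summable (hf : BlockBounds f) : Summable fun k => ∫ x, ‖f k x‖ ∂torusMeasure := by
  refine Summable.of_nonneg_of_le (fun k => integral_nonneg fun _ => norm_nonneg _) (fun k => ?_)
    (summable_inv_hSeq (10 ^ 9))
  refine (hf.integral_le k).trans ?_
  gcongr
  exact grad_mass_le k

theorem eLpNorm_le (hf : BlockBounds f) {p : ℝ} (hp : 1 ≤ p) (k : ℕ) :
    eLpNorm (f k) (ENNReal.ofReal p) torusMeasure ≤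
      ENNReal.ofReal (10 ^ 9 * ((hSeq k : ℝ) ^ (2 : ℝ) * (gSeq k : ℝ) ^ (4 - 6 / p))) := by
  have hp0 : 0 < p := by linarith
  have h1 : (0 : ℝ) < hSeq k := by exact_mod_cast (hSeq_pos k)
  have h2 : (0 : ℝ) < gSeq k := by exact_mod_cast (gSeq_pos k)
  have hA : ∫⁻ x, ‖f k x‖ₑ ^ (1 : ℝ) ∂torusMeasure ≤
      ENNReal.ofReal (10 ^ 9 * ((hSeq k : ℝ) ^ 2 * ((gSeq k : ℝ) ^ 2)⁻¹)) := by
    simp_rw [ENNReal.rpow_one]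
    rw [← ofReal_integral_norm_eq_lintegral_enorm (hf.integrable k)]
    exact ENNReal.ofReal_le_ofReal (hf.integral_le k)
  refine (eLpNorm_le_of_bound one_pos hp (hf.norm_le k) hA).trans (le_of_eq ?_)
  rw [ENNReal.ofReal_rpow_of_nonneg (by positivity) (by linarith),
    ← ENNReal.ofReal_mul (by positivity), ENNReal.ofReal_rpow_of_nonneg (by positivity)
    (by positivity)]
  congr 1
  have e : ((10 ^ 9 * ((hSeq k : ℝ) ^ (2 : ℝ) * (gSeq k : ℝ) ^ (4 - 6 / p))) ^ p) =
      (10 ^ 9 * ((hSeq k : ℝ) ^ 2 * (gSeq k : ℝ) ^ 4)) ^ (p - 1) *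
        (10 ^ 9 * ((hSeq k : ℝ) ^ 2 * ((gSeq k : ℝ) ^ 2)⁻¹)) := by
    have e1 : (hSeq k : ℝ) ^ 2 = (hSeq k : ℝ) ^ (2 : ℝ) := by norm_cast
    have e2 : (gSeq k : ℝ) ^ 4 = (gSeq k : ℝ) ^ (4 : ℝ) := by norm_cast
    have e3 : ((gSeq k : ℝ) ^ 2)⁻¹ = (gSeq k : ℝ) ^ (-2 : ℝ) := by
      rw [Real.rpow_neg h2.le]; norm_cast
    rw [e1, e2, e3, Real.mul_rpow (by positivity) (by positivity),
      Real.mul_rpow (by positivity) (by positivity), Real.mul_rpow (by positivity) (by positivity),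
      Real.mul_rpow (by positivity) (by positivity), ← Real.rpow_mul h1.le, ← Real.rpow_mul h2.le,
      ← Real.rpow_mul h1.le, ← Real.rpow_mul h2.le]
    have f1 : (10 ^ 9 : ℝ) ^ p = (10 ^ 9 : ℝ) ^ (p - 1) * 10 ^ 9 := by
      rw [Real.rpow_sub_one (by norm_num)]; field_simp
    have f2 : (hSeq k : ℝ) ^ (2 * p) = (hSeq k : ℝ) ^ (2 * (p - 1)) * (hSeq k : ℝ) ^ (2 : ℝ) := by
      rw [← Real.rpow_add h1]; ring_nf
    have f3 : (gSeq k : ℝ) ^ ((4 - 6 / p) * p) =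
        (gSeq k : ℝ) ^ (4 * (p - 1)) * (gSeq k : ℝ) ^ (-2 : ℝ) := by
      rw [← Real.rpow_add h2]; congr 1; field_simp; ring
    rw [f1, f2, f3]
    ring
  rw [← e, ← Real.rpow_mul (by positivity), mul_one_div_cancel hp0.ne', Real.rpow_one]

theorem memLp (hf : BlockBounds f) {p : ℝ≥0∞} (hp : 1 ≤ p) (hp' : p < 3 / 2) :
    MemLp (fun x => ∑' k, f k x) p torusMeasure := by
  refine memLp_tsum hf.integrable hf.summable hp ?_
  obtain ⟨r, rfl⟩ : ∃ r : ℝ, p = ENNReal.ofReal r :=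
    ⟨p.toReal, (ENNReal.ofReal_toReal (hp'.trans_le le_top).ne).symm⟩
  have hr : 1 ≤ r := by simpa using hp
  have hr0 : 0 < r := by linarith
  have hr' : r < 3 / 2 := by
    have h32 : (3 / 2 : ℝ≥0∞) = ENNReal.ofReal (3 / 2) := by
      rw [ENNReal.ofReal_div_of_pos (by norm_num)]; simp
    rw [h32] at hp'
    exact (ENNReal.ofReal_lt_ofReal_iff (by norm_num)).1 hp'
  have hδ : 0 < 6 / r - 4 := by
    rw [sub_pos, lt_div_iff₀ hr0]; linarith
  set b : ℕ → ℝ := fun k => 10 ^ 9 * ((hSeq k : ℝ) ^ (2 : ℝ) * (gSeq k : ℝ) ^ (4 - 6 / r)) with hb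
  have hb0 : ∀ k, 0 ≤ b k := fun k => by positivity
  have hsum : Summable b := by
    refine Summable.of_norm_bounded_eventually_nat (summable_inv_hSeq (10 ^ 9)) ?_
    -- With `gSeq k = hSeq k ^ (k + 3)` the exponent of `hSeq k` is `2 - (k + 3) * (6 / r - 4)`,
    -- which is at most `-1` once `k` exceeds this threshold. A fixed exponent in `gSeq` could not
    -- serve all `p < 3 / 2`.
    obtain ⟨N, hN⟩ := exists_nat_gt (3 / (6 / r - 4))
    filter_upwards [eventually_ge_atTop N] with k hk
    rw [Real.norm_of_nonneg (hb0 k)]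
    have h1 : (1 : ℝ) ≤ hSeq k := one_le_hSeq k
    have h0 : (0 : ℝ) < hSeq k := by linarith
    have hg : (gSeq k : ℝ) = (hSeq k : ℝ) ^ ((k : ℝ) + 3) := by
      rw [gSeq]; push_cast; norm_cast
    simp only [hb]
    gcongr
    rw [hg, ← Real.rpow_mul h0.le, ← Real.rpow_add h0, ← Real.rpow_neg_one]
    refine Real.rpow_le_rpow_of_exponent_le h1 ?_
    have hk' : (N : ℝ) ≤ k := by exact_mod_cast hk
    rw [div_lt_iff₀ hδ] at hN
    nlinarith
  refine ne_top_of_le_ne_top ?_ (ENNReal.tsum_le_tsum fun k => hf.eLpNorm_le hr k)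
  rw [← ENNReal.ofReal_tsum_of_nonneg hb0 hsum]
  exact ENNReal.ofReal_ne_top

end BlockBounds

/-- The higher block is measured in `L¹` and the lower one in sup norm. For `k ≤ l` the velocity
costs at most `gSeq l` against `gSeq l ^ (-2)`; for `l < k` the gradient costs at most `hSeq k ^ 4`,
because `hSeq l * gSeq l ≤ hSeq k`. -/
theorem integral_norm_vel_mul_grad_le (k l : ℕ) (i i' j : Fin 2) :
    ∫ x, ‖vel k j x * grad l i i' x‖ ∂torusMeasure ≤
      10 ^ 18 * ((1 / 2) ^ k * (1 / 2) ^ l) := by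
  have hv := continuous_vel k j
  have hg := continuous_grad l i i'
  have half : ∀ m, ((1 : ℝ) / 4) ^ m = (1 / 2) ^ m * (1 / 2) ^ m := fun m => by
    rw [← mul_pow]; norm_num
  have hk1 := one_le_hSeq k
  have hl1 := one_le_hSeq l
  have hk2 := hSeq_pow_le_gSeq_real k
  have hl2 := hSeq_pow_le_gSeq_real l
  have hk0 : (0 : ℝ) < hSeq k := by linarith
  have hl0 : (0 : ℝ) < hSeq l := by linarith
  have hgk0 : (0 : ℝ) < gSeq k := (pow_pos hk0 3).trans_le hk2
  have hgl0 : (0 : ℝ) < gSeq l := (pow_pos hl0 3).trans_le hl2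
  rcases le_or_gt k l with h | h
  · have hgkl : (gSeq k : ℝ) ≤ gSeq l := by exact_mod_cast gSeq_mono h
    calc ∫ x, ‖vel k j x * grad l i i' x‖ ∂torusMeasure
        ≤ ∫ x, (10 ^ 9 * ((gSeq k : ℝ) / hSeq k)) * ‖grad l i i' x‖ ∂torusMeasure := by
          refine integral_mono (integrable_of_continuous (by fun_prop))
            (integrable_of_continuous (by fun_prop)) fun x => ?_
          simp only [norm_mul]
          gcongr
          exact norm_vel_le k j x
      _ ≤ (10 ^ 9 * (gSeq l : ℝ)) * (10 ^ 9 * ((hSeq l : ℝ) ^ 2 * ((gSeq l : ℝ) ^ 2)⁻¹)) := by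
          rw [integral_const_mul]
          have e1 : (gSeq k : ℝ) / hSeq k ≤ gSeq l := (div_le_self hgk0.le hk1).trans hgkl
          have e2 := integral_norm_grad_psi_le l i i'
          gcongr
      _ = 10 ^ 18 * ((hSeq l : ℝ) ^ 2 / gSeq l) := by field_simp
      _ ≤ 10 ^ 18 * (hSeq l : ℝ)⁻¹ := by
          gcongr
          rw [div_le_iff₀ hgl0, inv_mul_eq_div, le_div_iff₀ hl0]
          linarith
      _ ≤ 10 ^ 18 * ((1 / 2) ^ k * (1 / 2) ^ l) := by
          gcongr
          refine (inv_hSeq_le l).trans ?_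
          rw [half]
          gcongr ?_ * _
          exact pow_le_pow_of_le_one (by norm_num) (by norm_num) h
  · have hgl : (hSeq l : ℝ) * gSeq l ≤ hSeq k := by
      have := eight_mul_le_hSeq h
      have h2 : hSeq l * gSeq l ≤ hSeq k := by omega
      exact_mod_cast h2
    calc ∫ x, ‖vel k j x * grad l i i' x‖ ∂torusMeasure
        ≤ ∫ x, ‖vel k j x‖ * (10 ^ 9 * ((hSeq l : ℝ) ^ 2 * (gSeq l : ℝ) ^ 4)) ∂torusMeasure := by
          refine integral_mono (integrable_of_continuous (by fun_prop))
            (integrable_of_continuous (by fun_prop)) fun x => ?_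
          simp only [norm_mul]
          gcongr
          exact norm_grad_le l i i' x
      _ ≤ (10 ^ 9 * ((hSeq k : ℝ) * (gSeq k : ℝ) ^ 2)⁻¹) * (10 ^ 9 * (hSeq k : ℝ) ^ 4) := by
          rw [integral_mul_const]
          have e1 : (hSeq l : ℝ) ^ 2 * (gSeq l : ℝ) ^ 4 ≤ (hSeq k : ℝ) ^ 4 := by
            calc (hSeq l : ℝ) ^ 2 * (gSeq l : ℝ) ^ 4 ≤ (hSeq l : ℝ) ^ 4 * (gSeq l : ℝ) ^ 4 := by
                  gcongr
                  norm_num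
              _ = ((hSeq l : ℝ) * gSeq l) ^ 4 := by ring
              _ ≤ _ := by gcongr
          have e2 := integral_norm_vel_le k j
          gcongr
      _ = 10 ^ 18 * ((hSeq k : ℝ) * ((hSeq k : ℝ) ^ 2 * ((gSeq k : ℝ) ^ 2)⁻¹)) := by
          field_simp
      _ ≤ 10 ^ 18 * (hSeq k : ℝ)⁻¹ := by
          gcongr
          have : (hSeq k : ℝ) ^ 4 ≤ (gSeq k : ℝ) ^ 2 := by
            calc (hSeq k : ℝ) ^ 4 ≤ (hSeq k : ℝ) ^ 6 := pow_le_pow_right₀ hk1 (by norm_num)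
              _ = ((hSeq k : ℝ) ^ 3) ^ 2 := by ring
              _ ≤ _ := by gcongr
          rw [← mul_assoc, ← div_eq_mul_inv, div_le_iff₀ (by positivity), inv_mul_eq_div,
            le_div_iff₀ hk0]
          linarith
      _ ≤ 10 ^ 18 * ((1 / 2) ^ k * (1 / 2) ^ l) := by
          gcongr
          refine (inv_hSeq_le k).trans ?_
          rw [half]
          gcongr _ * ?_
          exact pow_le_pow_of_le_one (by norm_num) (by norm_num) h.le

theorem summable_vel_mul_grad (i i' j : Fin 2) :
    Summable fun p : ℕ × ℕ => ∫ x, ‖vel p.1 j x * grad p.2 i i' x‖ ∂torusMeasure := by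
  refine Summable.of_nonneg_of_le (fun p => integral_nonneg fun _ => norm_nonneg _)
    (fun p => integral_norm_vel_mul_grad_le p.1 p.2 i i' j) (Summable.mul_left _ ?_)
  exact Summable.mul_of_nonneg
    (summable_geometric_of_lt_one (by norm_num : (0 : ℝ) ≤ 1 / 2) (by norm_num))
    (summable_geometric_of_lt_one (by norm_num : (0 : ℝ) ≤ 1 / 2) (by norm_num))
    (fun _ => by positivity) (fun _ => by positivity)

/-! ### The flow -/

/-- The intermittent flow: the sum of all blocks. -/
def flow (x : Torus2) : Plane := WithLp.toLp 2 fun i => ∑' k, vel k i x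

theorem integrable_flow (i : Fin 2) : Integrable (fun x => flow x i) torusMeasure :=
  integrable_tsum (blockBounds_vel i).integrable (blockBounds_vel i).summable

/-- The gradient of the intermittent flow. -/
def flowGrad (x : Torus2) : Matrix (Fin 2) (Fin 2) ℝ := fun i j => ∑' k, grad k i j x

theorem integrable_flowGrad (i j : Fin 2) : Integrable (fun x => flowGrad x i j) torusMeasure :=
  integrable_tsum (blockBounds_grad i j).integrable (blockBounds_grad i j).summable

theorem integral_torusPartial_mul_trigPoly {φ : Torus2 → ℝ} (hφ : IsTestFunction φ) (j : Fin 2)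
    (s : Finset Freq) (c : Freq → ℂ) :
    ∫ x, (torusPartial j φ x : ℂ) * trigPoly s c x ∂torusMeasure =
      -∫ x, (φ x : ℂ) * trigPoly s (fun α => 2 * Real.pi * Complex.I * α j * c α) x
        ∂torusMeasure := by
  have hc := continuous_testFunction hφ
  have hc' := continuous_torusPartial hφ j
  have h1 : ∀ x, (torusPartial j φ x : ℂ) * trigPoly s c x =
      ∑ α ∈ s, c α * (mFourier α x * (torusPartial j φ x : ℂ)) := by
    intro x
    rw [trigPoly, Finset.mul_sum]
    exact Finset.sum_congr rfl fun α _ => by ring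
  have h2 : ∀ x, (φ x : ℂ) * trigPoly s (fun α => 2 * Real.pi * Complex.I * α j * c α) x =
      ∑ α ∈ s, c α * ((2 * Real.pi * Complex.I * α j * mFourier α x) * (φ x : ℂ)) := by
    intro x
    rw [trigPoly, Finset.mul_sum]
    exact Finset.sum_congr rfl fun α _ => by ring
  simp_rw [h1, h2]
  rw [integral_finsetSum _ fun α _ => integrable_of_continuous (by fun_prop),
    integral_finsetSum _ fun α _ => integrable_of_continuous (by fun_prop),
    ← Finset.sum_neg_distrib]
  refine Finset.sum_congr rfl fun α _ => ?_
  rw [integral_const_mul, integral_const_mul, integral_mFourier_mul_torusPartial hφ]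
  ring

theorem integral_torusPartial_mul_vel {φ : Torus2 → ℝ} (hφ : IsTestFunction φ) (k : ℕ)
    (i j : Fin 2) :
    ∫ x, (torusPartial j φ x : ℂ) * (vel k i x : ℂ) ∂torusMeasure =
      -∫ x, (φ x : ℂ) * (grad k i j x : ℂ) ∂torusMeasure := by
  simp_rw [ofReal_vel, ofReal_grad]
  exact integral_torusPartial_mul_trigPoly hφ j _ _

theorem exists_norm_ofReal_le {f : Torus2 → ℝ} (hf : Continuous f) : ∃ C, ∀ x, ‖(f x : ℂ)‖ ≤ C := by
  obtain ⟨C, hC⟩ := isCompact_univ.exists_bound_of_continuousOn (f := f) hf.continuousOn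
  exact ⟨C, fun x => by rw [Complex.norm_real]; exact hC x (Set.mem_univ x)⟩

theorem hasWeakGradient_flow : HasWeakGradient flow flowGrad := by
  refine ⟨integrable_flow, integrable_flowGrad, fun i j φ hφ => ?_⟩
  have hc := continuous_testFunction hφ
  have hc' := continuous_torusPartial hφ j
  obtain ⟨C, hC⟩ := exists_norm_ofReal_le hc
  obtain ⟨C', hC'⟩ := exists_norm_ofReal_le hc'
  have h1 := hasSum_integral_mul_of_bounded (blockBounds_vel i).integrable
    (blockBounds_vel i).summable
    (w := fun x => (torusPartial j φ x : ℂ)) (by fun_prop) hC'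
  have h2 := hasSum_integral_mul_of_bounded (blockBounds_grad i j).integrable
    (blockBounds_grad i j).summable
    (w := fun x => (φ x : ℂ)) (by fun_prop) hC
  simp_rw [integral_torusPartial_mul_vel hφ] at h1
  have h3 := h1.unique h2.neg
  have e1 : ((∫ x, flow x i * torusPartial j φ x ∂torusMeasure : ℝ) : ℂ) =
      ∫ x, (torusPartial j φ x : ℂ) * ((∑' k, vel k i x : ℝ) : ℂ) ∂torusMeasure := by
    rw [← integral_complex_ofReal]
    refine integral_congr_ae (ae_of_all _ fun x => ?_)
    simp only [flow, Complex.ofReal_mul]; ring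
  have e2 : ((∫ x, flowGrad x i j * φ x ∂torusMeasure : ℝ) : ℂ) =
      ∫ x, (φ x : ℂ) * ((∑' k, grad k i j x : ℝ) : ℂ) ∂torusMeasure := by
    rw [← integral_complex_ofReal]
    refine integral_congr_ae (ae_of_all _ fun x => ?_)
    simp only [flowGrad, Complex.ofReal_mul]; ring
  have : ((∫ x, flow x i * torusPartial j φ x ∂torusMeasure : ℝ) : ℂ) =
      ((-∫ x, flowGrad x i j * φ x ∂torusMeasure : ℝ) : ℂ) := by
    rw [Complex.ofReal_neg, e1, e2, h3]
  exact_mod_cast this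

theorem flowGrad_one_one (x : Torus2) : flowGrad x 1 1 = -flowGrad x 0 0 := by
  simp only [flowGrad, ← tsum_neg]
  refine tsum_congr fun k => ?_
  have h : ∀ α, gradCoeff (psi k) 1 1 α = -gradCoeff (psi k) 0 0 α := fun α => by
    have := sum_gradCoeff_diag (psi k) α
    rw [Fin.sum_univ_two] at this
    exact eq_neg_of_add_eq_zero_right this
  simp [grad, trigPoly, h]

theorem isDivergenceFree_flow : IsDivergenceFree flow := by
  refine ⟨integrable_flow, fun φ hφ => ?_⟩
  have hi : ∀ j, Integrable (fun x => flow x j * torusPartial j φ x) torusMeasure := by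
    intro j
    have hc' := continuous_torusPartial hφ j
    obtain ⟨C, hC⟩ := isCompact_univ.exists_bound_of_continuousOn hc'.continuousOn
    exact (integrable_flow j).mul_bdd hc'.aestronglyMeasurable
      (ae_of_all _ fun x => hC x (Set.mem_univ x))
  rw [integral_finsetSum _ fun j _ => hi j, Fin.sum_univ_two,
    hasWeakGradient_flow.2.2 0 0 φ hφ, hasWeakGradient_flow.2.2 1 1 φ hφ]
  simp_rw [flowGrad_one_one, neg_mul, integral_neg]
  ring

theorem memSobolevOne_flow {p : ℝ≥0∞} (hp : 1 ≤ p) (hlt : p < 3 / 2) : MemSobolevOne p flow :=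
  ⟨fun i => (blockBounds_vel i).memLp hp hlt, flowGrad, hasWeakGradient_flow,
    fun i j => (blockBounds_grad i j).memLp hp hlt⟩

/-! ### Fourier coefficients of the flow -/

theorem norm_mFourier_apply_le (α : Freq) : ∀ x : Torus2, ‖mFourier α x‖ ≤ 1 := fun x =>
  (norm_mFourier_apply α x).le

theorem velCoeff_psi_eq_zero {k : ℕ} {α : Freq} (h : α ∉ freqs k) (i : Fin 2) :
    velCoeff (psi k) i α = 0 := by
  simp [velCoeff, psi_eq_zero h]

theorem hasSum_mFourierCoeff_flow (i : Fin 2) (α : Freq) :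
    HasSum (fun k => velCoeff (psi k) i α) (mFourierCoeff (fun y => (flow y i : ℂ)) α) := by
  have h := hasSum_integral_mul_of_bounded (blockBounds_vel i).integrable
    (blockBounds_vel i).summable
    (w := fun x => mFourier (-α) x) (by fun_prop) (norm_mFourier_apply_le (-α))
  have e : mFourierCoeff (fun y => (flow y i : ℂ)) α =
      ∫ x, mFourier (-α) x * ((∑' k, vel k i x : ℝ) : ℂ) ∂torusMeasure := rfl
  rw [e]
  convert h using 2 with k
  simp_rw [ofReal_vel]
  rw [integral_mFourier_mul_trigPoly, neg_neg]
  split_ifs with hk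
  · rfl
  · exact velCoeff_psi_eq_zero hk i

theorem norm_freq_le (α : Freq) : ‖freq α‖ ≤ |(α 0 : ℝ)| + |(α 1 : ℝ)| := by
  rw [EuclideanSpace.norm_eq, Real.sqrt_le_left (by positivity)]
  simp only [freq, Fin.sum_univ_two, Real.norm_eq_abs]
  nlinarith [abs_nonneg (α 0 : ℝ), abs_nonneg (α 1 : ℝ)]

theorem abs_le_norm_freq (α : Freq) (i : Fin 2) : |(α i : ℝ)| ≤ ‖freq α‖ := by
  have := PiLp.norm_apply_le (freq α) i
  simpa [freq] using this

theorem norm_freq_le_of_mem {k : ℕ} {α : Freq} (h : α ∈ freqs k) :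
    ‖freq α‖ ≤ 148 * freqScale k := by
  have h0 := abs_le_of_mem_freqs h 0
  have h1 := abs_le_of_mem_freqs h 1
  linarith [norm_freq_le α]

theorem le_norm_freq_of_mem {k : ℕ} {α : Freq} (h : α ∈ freqs k) :
    22 * freqScale k ≤ ‖freq α‖ := by
  have h0 : (22 : ℝ) * freqScale k ≤ |(α 0 : ℝ)| := by exact_mod_cast le_abs_of_mem_block h
  exact h0.trans (abs_le_norm_freq α 0)

theorem freqScale_le_real {j k : ℕ} (h : j < k) : (512 : ℝ) * freqScale j ≤ freqScale k := by
  exact_mod_cast freqScale_le_freqScale h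

/-- Blocks occupy the annuli between 22 and 148 times their frequency scales, and these scales grow
by at least 512. -/
theorem freqs_disjoint {j k : ℕ} {α : Freq} (hj : α ∈ freqs j) (hk : α ∈ freqs k) : j = k := by
  wlog h : j < k generalizing j k
  · rcases Nat.lt_or_ge k j with h' | h'
    · exact (this hk hj h').symm
    · omega
  have h1 := norm_freq_le_of_mem hj
  have h2 := le_norm_freq_of_mem hk
  have h3 := freqScale_le_real h
  have h4 : (0 : ℝ) < freqScale j := by exact_mod_cast freqScale_pos j
  linarith

theorem mFourierCoeff_flow_of_mem {k : ℕ} {α : Freq} (h : α ∈ freqs k) (i : Fin 2) :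
    mFourierCoeff (fun y => (flow y i : ℂ)) α = velCoeff (psi k) i α := by
  refine (hasSum_mFourierCoeff_flow i α).unique ?_
  exact hasSum_single k fun l hl => velCoeff_psi_eq_zero (fun hm => hl (freqs_disjoint hm h)) i

theorem mFourierCoeff_flow_of_notMem {α : Freq} (h : ∀ k, α ∉ freqs k) (i : Fin 2) :
    mFourierCoeff (fun y => (flow y i : ℂ)) α = 0 := by
  refine (hasSum_mFourierCoeff_flow i α).unique ?_
  simp_rw [fun k => velCoeff_psi_eq_zero (h k) i]
  exact hasSum_zero

/-! ### Besov regularity -/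

theorem cutoff_eq_zero {χ : Plane → ℝ} (hχ : IsCutoff χ) {ξ : Plane} (h : 1 < ‖ξ‖) : χ ξ = 0 := by
  by_contra hne
  have := hχ.support_subset (subset_tsupport χ hne)
  rw [mem_closedBall_zero_iff] at this
  linarith

theorem exists_cutoff_le {χ : Plane → ℝ} (hχ : IsCutoff χ) : ∃ C : ℝ, 0 < C ∧ ∀ ξ, |χ ξ| ≤ C := by
  have hc : HasCompactSupport χ :=
    (isCompact_closedBall (0 : Plane) 1).of_isClosed_subset (isClosed_tsupport χ) hχ.support_subset
  obtain ⟨C, hC⟩ := hc.exists_bound_of_continuous hχ.smooth.continuous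
  exact ⟨max C 1, by positivity, fun ξ => (hC ξ).trans (le_max_left _ _)⟩

theorem norm_dyadic (q : ℕ) (α : Freq) : ‖((2 : ℝ) ^ q)⁻¹ • freq α‖ = ‖freq α‖ / 2 ^ q := by
  rw [norm_smul, norm_inv, norm_pow, Real.norm_ofNat, inv_mul_eq_div]

theorem shell_eq_zero_of_le {χ : Plane → ℝ} (hχ : IsCutoff χ) {ξ : Plane} (h : ‖ξ‖ ≤ 1 / 2) :
    shell χ ξ = 0 := by
  rw [shell, hχ.eq_one ξ h, hχ.eq_one, sub_self]
  rw [norm_smul]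
  norm_num
  linarith [norm_nonneg ξ]

theorem shell_eq_zero_of_lt {χ : Plane → ℝ} (hχ : IsCutoff χ) {ξ : Plane} (h : 2 < ‖ξ‖) :
    shell χ ξ = 0 := by
  rw [shell, cutoff_eq_zero hχ (by linarith : 1 < ‖ξ‖), cutoff_eq_zero hχ, sub_self]
  rw [norm_smul]
  norm_num
  linarith

theorem scale_bounds_of_shell_ne_zero {χ : Plane → ℝ} (hχ : IsCutoff χ) {q k : ℕ} {α : Freq}
    (hα : α ∈ freqs k) (h : shell χ (((2 : ℝ) ^ q)⁻¹ • freq α) ≠ 0) :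
    (2 : ℝ) ^ q ≤ 296 * freqScale k ∧ 11 * (freqScale k : ℝ) ≤ 2 ^ q := by
  have h1 : 1 / 2 < ‖freq α‖ / 2 ^ q := by
    rw [← norm_dyadic]
    by_contra hc
    exact h (shell_eq_zero_of_le hχ (not_lt.1 hc))
  have h2 : ‖freq α‖ / 2 ^ q ≤ 2 := by
    rw [← norm_dyadic]
    by_contra hc
    exact h (shell_eq_zero_of_lt hχ (not_le.1 hc))
  have hq : (0 : ℝ) < 2 ^ q := by positivity
  rw [lt_div_iff₀ hq] at h1
  rw [div_le_iff₀ hq] at h2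
  have h3 := norm_freq_le_of_mem hα
  have h4 := le_norm_freq_of_mem hα
  constructor <;> linarith

theorem lpComponent_flow_eq_zero {χ : Plane → ℝ} {q : ℕ} (i : Fin 2)
    (h : ∀ k, ∀ α ∈ freqs k, shell χ (((2 : ℝ) ^ q)⁻¹ • freq α) = 0) :
    lpComponent χ q (fun x => flow x i) = 0 := by
  funext x
  rw [lpComponent, dyadicMultiplier, Pi.zero_apply]
  convert tsum_zero with α
  by_cases hα : ∃ k, α ∈ freqs k
  · obtain ⟨k, hk⟩ := hα
    simp [h k α hk]
  · rw [mFourierCoeff_flow_of_notMem (not_exists.1 hα)]; simp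

/-- A dyadic shell meets at most one block: it confines `2 ^ q` to between 11 and 296 times the
frequency scale, a ratio below 512. -/
theorem lpComponent_flow_eq {χ : Plane → ℝ} (hχ : IsCutoff χ) {q k : ℕ} {α : Freq} (i : Fin 2)
    (hα : α ∈ freqs k) (h : shell χ (((2 : ℝ) ^ q)⁻¹ • freq α) ≠ 0) :
    lpComponent χ q (fun x => flow x i) = trigPoly (freqs k) fun β =>
      (shell χ (((2 : ℝ) ^ q)⁻¹ • freq β) : ℂ) * velCoeff (psi k) i β := by
  funext x
  rw [lpComponent, dyadicMultiplier, trigPoly, tsum_eq_sum (s := freqs k)]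
  · exact Finset.sum_congr rfl fun β hβ => by rw [mFourierCoeff_flow_of_mem hβ]
  · intro β hβ
    by_cases hl : ∃ l, β ∈ freqs l
    · obtain ⟨l, hl⟩ := hl
      have : shell χ (((2 : ℝ) ^ q)⁻¹ • freq β) = 0 := by
        by_contra hne
        have h1 := scale_bounds_of_shell_ne_zero hχ hα h
        have h2 := scale_bounds_of_shell_ne_zero hχ hl hne
        have hk0 : (0 : ℝ) < freqScale k := by exact_mod_cast freqScale_pos k
        have hl0 : (0 : ℝ) < freqScale l := by exact_mod_cast freqScale_pos l
        rcases lt_trichotomy k l with h' | h' | h'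
        · have := freqScale_le_real h'; linarith
        · exact hβ (h' ▸ hl)
        · have := freqScale_le_real h'; linarith
      simp [this]
    · rw [mFourierCoeff_flow_of_notMem (not_exists.1 hl)]; simp

theorem memBesovTop_flow {χ : Plane → ℝ} (hχ : IsCutoff χ) : MemBesovTop χ (1 / 3) 3 flow := by
  obtain ⟨K, hK0, hK⟩ := exists_cutoff_le hχ
  intro i
  refine ⟨integrable_flow i, (14000000 * K).toNNReal, fun q => ?_⟩
  by_cases hex : ∃ k, ∃ α ∈ freqs k, shell χ (((2 : ℝ) ^ q)⁻¹ • freq α) ≠ 0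
  swap
  · push Not at hex
    rw [lpComponent_flow_eq_zero i hex]
    simp
  obtain ⟨k, α, hα, hne⟩ := hex
  rw [lpComponent_flow_eq hχ i hα hne]
  set c : Freq → ℂ := fun β =>
    (shell χ (((2 : ℝ) ^ q)⁻¹ • freq β) : ℂ) * velCoeff (psi k) i β with hc
  have h0 : (0 : ℝ) < hSeq k := by exact_mod_cast (hSeq_pos k)
  have g0 : (0 : ℝ) < gSeq k := by exact_mod_cast (gSeq_pos k)
  have hcb : ∀ β, ‖c β‖ ≤ (2 * K) * ‖velCoeff (psi k) i β‖ := by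
    intro β
    simp only [hc, norm_mul, Complex.norm_real, Real.norm_eq_abs]
    gcongr
    rw [shell]
    refine (abs_sub _ _).trans ?_
    linarith [hK ((2 : ℝ)⁻¹ • ((2 : ℝ) ^ q)⁻¹ • freq β), hK (((2 : ℝ) ^ q)⁻¹ • freq β)]
  -- One constant serves both the sup and the `L²` bound, so that `sup * (L²)²` becomes an exact
  -- cube in `hprod`.
  set P : ℝ := 2 * K * 599400 with hP
  have hB : ∀ x, ‖trigPoly (freqs k) c x‖ ≤ P * ((gSeq k : ℝ) / hSeq k) := by
    intro x
    refine (norm_trigPoly_le _ _ _).trans ?_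
    calc ∑ β ∈ freqs k, ‖c β‖ ≤ ∑ β ∈ freqs k, (2 * K) * ‖velCoeff (psi k) i β‖ :=
          Finset.sum_le_sum fun β _ => hcb β
      _ = (2 * K) * ∑ β ∈ freqs k, ‖velCoeff (psi k) i β‖ := by rw [Finset.mul_sum]
      _ ≤ (2 * K) * (599400 * ((gSeq k : ℝ) / hSeq k)) := by
          gcongr; exact sum_norm_velCoeff_le k i
      _ = _ := by rw [hP]; ring
  have hA : ∫⁻ x, ‖trigPoly (freqs k) c x‖ₑ ^ (2 : ℝ) ∂torusMeasure ≤
      ENNReal.ofReal ((P * ((hSeq k : ℝ) * (gSeq k : ℝ) ^ 2)⁻¹) ^ 2) := by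
    have hcont := continuous_trigPoly (freqs k) c
    have e : ∀ x, ‖trigPoly (freqs k) c x‖ₑ ^ (2 : ℝ) =
        ENNReal.ofReal (‖trigPoly (freqs k) c x‖ ^ 2) := by
      intro x
      rw [ENNReal.ofReal_pow (norm_nonneg _), ofReal_norm]
      norm_cast
    simp_rw [e]
    rw [← ofReal_integral_eq_lintegral_ofReal (integrable_of_continuous (by fun_prop))
      (ae_of_all _ fun x => by positivity), integral_norm_trigPoly_sq]
    refine ENNReal.ofReal_le_ofReal ?_
    calc ∑ β ∈ freqs k, ‖c β‖ ^ 2 ≤ ∑ β ∈ freqs k, (2 * K) ^ 2 * ‖velCoeff (psi k) i β‖ ^ 2 := by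
          refine Finset.sum_le_sum fun β _ => ?_
          rw [← mul_pow]
          have := hcb β
          gcongr
      _ = (2 * K) ^ 2 * ∑ β ∈ freqs k, ‖velCoeff (psi k) i β‖ ^ 2 := by rw [Finset.mul_sum]
      _ ≤ (2 * K) ^ 2 * (599400 * ((hSeq k : ℝ) * (gSeq k : ℝ) ^ 2)⁻¹) ^ 2 := by
          gcongr
          refine (sum_norm_velCoeff_sq_le k i).trans ?_
          gcongr
          norm_num
      _ = _ := by rw [hP]; ring
  have hL := eLpNorm_le_of_bound (p := 3) (by norm_num) (by norm_num) hB hA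
  have h3 : ENNReal.ofReal 3 = 3 := by simp
  rw [h3] at hL
  have hprod : ENNReal.ofReal (P * ((gSeq k : ℝ) / hSeq k)) ^ ((3 : ℝ) - 2) *
      ENNReal.ofReal ((P * ((hSeq k : ℝ) * (gSeq k : ℝ) ^ 2)⁻¹) ^ 2) =
      ENNReal.ofReal (P * ((hSeq k : ℝ) * gSeq k)⁻¹) ^ (3 : ℝ) := by
    rw [show (3 : ℝ) - 2 = 1 by norm_num, ENNReal.rpow_one, ← ENNReal.ofReal_mul (by positivity),
      ENNReal.ofReal_rpow_of_nonneg (by positivity) (by norm_num)]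
    congr 1
    norm_cast
    field_simp
    push_cast
    ring
  rw [hprod, ← ENNReal.rpow_mul, mul_one_div_cancel (by norm_num), ENNReal.rpow_one] at hL
  -- `296 ≤ 7 ^ 3`, and `freqScale k` is the cube of `hSeq k * gSeq k`.
  have hq : ((2 : ℝ) ^ q) ^ (1 / 3 : ℝ) ≤ 7 * ((hSeq k : ℝ) * gSeq k) := by
    have h1 := (scale_bounds_of_shell_ne_zero hχ hα hne).1
    have h2 : (2 : ℝ) ^ q ≤ (7 * ((hSeq k : ℝ) * gSeq k)) ^ (3 : ℝ) := by
      refine h1.trans ?_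
      rw [freqScale, spacing, scale]
      push_cast
      norm_cast
      ring_nf
      gcongr
      norm_num
    calc ((2 : ℝ) ^ q) ^ (1 / 3 : ℝ) ≤ ((7 * ((hSeq k : ℝ) * gSeq k)) ^ (3 : ℝ)) ^ (1 / 3 : ℝ) := by
          gcongr
      _ = _ := by rw [← Real.rpow_mul (by positivity)]; norm_num
  calc ENNReal.ofReal (((2 : ℝ) ^ q) ^ (1 / 3 : ℝ)) * eLpNorm (trigPoly (freqs k) c) 3 torusMeasure
      ≤ ENNReal.ofReal (7 * ((hSeq k : ℝ) * gSeq k)) *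
        ENNReal.ofReal (P * ((hSeq k : ℝ) * gSeq k)⁻¹) := by gcongr
    _ = ENNReal.ofReal (7 * P) := by
        rw [← ENNReal.ofReal_mul (by positivity)]
        congr 1
        field_simp
    _ ≤ ENNReal.ofReal (14000000 * K) := by
        refine ENNReal.ofReal_le_ofReal ?_
        rw [hP]; linarith

/-! ### Advection -/

theorem integrable_vel_mul_grad (i i' j : Fin 2) (p : ℕ × ℕ) :
    Integrable (fun x => vel p.1 j x * grad p.2 i i' x) torusMeasure :=
  integrable_of_continuous ((continuous_vel _ _).mul (continuous_grad _ _ _))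

theorem ae_flow_mul_flowGrad (i i' j : Fin 2) :
    ∀ᵐ x ∂torusMeasure, flow x j * flowGrad x i i' =
      ∑' p : ℕ × ℕ, vel p.1 j x * grad p.2 i i' x :=
  ae_tsum_mul_tsum (blockBounds_vel j).integrable (blockBounds_vel j).summable
    (blockBounds_grad i i').integrable (blockBounds_grad i i').summable

theorem integrable_flow_mul_flowGrad (i i' j : Fin 2) :
    Integrable (fun x => flow x j * flowGrad x i i') torusMeasure :=
  (integrable_tsum (integrable_vel_mul_grad i i' j) (summable_vel_mul_grad i i' j)).congr
    ((ae_flow_mul_flowGrad i i' j).mono fun _ h => h.symm)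

theorem integrable_advection (i : Fin 2) :
    Integrable (advection flow flowGrad i) torusMeasure :=
  integrable_finsetSum _ fun j _ => integrable_flow_mul_flowGrad i j j

theorem hasSum_integral_mul_advection {w : Torus2 → ℂ} (hw : Continuous w) (i : Fin 2) :
    HasSum (fun p : ℕ × ℕ => ∑ j, ∫ x, w x * ((vel p.1 j x : ℂ) * (grad p.2 i j x : ℂ))
      ∂torusMeasure) (∫ x, w x * (advection flow flowGrad i x : ℂ) ∂torusMeasure) := by
  obtain ⟨C, hC⟩ := isCompact_univ.exists_bound_of_continuousOn hw.continuousOn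
  have hC' : ∀ x, ‖w x‖ ≤ C := fun x => hC x (Set.mem_univ x)
  have h : ∀ j, HasSum (fun p : ℕ × ℕ =>
      ∫ x, w x * ((vel p.1 j x : ℂ) * (grad p.2 i j x : ℂ)) ∂torusMeasure)
      (∫ x, w x * ((flow x j * flowGrad x i j : ℝ) : ℂ) ∂torusMeasure) := by
    intro j
    have h1 := hasSum_integral_mul_of_bounded (integrable_vel_mul_grad i j j)
      (summable_vel_mul_grad i j j) hw.aestronglyMeasurable hC'
    simp only [Complex.ofReal_mul] at h1
    convert h1 using 1
    refine integral_congr_ae ?_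
    filter_upwards [ae_flow_mul_flowGrad i j j] with x hx
    rw [hx]
  have h2 := hasSum_sum fun j (_ : j ∈ Finset.univ) => h j
  convert h2 using 1
  have hint : ∀ j ∈ Finset.univ, Integrable
      (fun x => w x * ((flow x j * flowGrad x i j : ℝ) : ℂ)) torusMeasure := fun j _ =>
    (integrable_flow_mul_flowGrad i j j).ofReal.bdd_mul hw.aestronglyMeasurable (ae_of_all _ hC')
  rw [← integral_finsetSum _ hint]
  refine integral_congr_ae (ae_of_all _ fun x => ?_)
  simp only [advection, Complex.ofReal_sum, Finset.mul_sum]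

/-! ### Triads only occur inside a block -/

/-- The first coordinates of the frequencies of the `k`-th block satisfy this. -/
def IsMode (k : ℕ) (x : ℤ) : Prop :=
  (spacing k : ℤ) ∣ x ∧ 22 * (freqScale k : ℤ) ≤ |x| ∧ |x| ≤ 74 * freqScale k

theorem isMode_of_mem {k : ℕ} {α : Freq} (h : α ∈ freqs k) : IsMode k (α 0) :=
  ⟨dvd_of_mem_block h 0, le_abs_of_mem_block h, abs_le_of_mem_block h 0⟩

/-- If `z` alone lies in the highest block, it is too large to be balanced. If `y` lies there too,
`x` is a multiple of the spacing of that block yet smaller than it, so `x = 0`, which the lower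
bound for modes excludes. -/
theorem IsMode.not_lt_and_le {p q r : ℕ} {x y z : ℤ} (hx : IsMode p x) (hy : IsMode q y)
    (hz : IsMode r z) (h : x + y + z = 0) : ¬(p < r ∧ q ≤ r) := by
  rintro ⟨hp, hq⟩
  have hM : (0 : ℤ) < spacing r := by exact_mod_cast spacing_pos r
  have hLp : (0 : ℤ) < freqScale p := by exact_mod_cast freqScale_pos p
  have hpM : 512 * (freqScale p : ℤ) ≤ spacing r := by exact_mod_cast freqScale_le_spacing hp
  have hML : (spacing r : ℤ) ≤ freqScale r := by
    exact_mod_cast Nat.le_mul_of_pos_right _ (scale_pos r)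
  rcases hq.lt_or_eq with hq | rfl
  · have hqM : 512 * (freqScale q : ℤ) ≤ spacing r := by exact_mod_cast freqScale_le_spacing hq
    have e : z = -(x + y) := by linarith
    have h1 := hz.2.1
    rw [e, abs_neg] at h1
    have h2 := abs_add_le x y
    linarith [hx.2.2, hy.2.2]
  · have hd : (spacing q : ℤ) ∣ x := by
      have e : x = -(y + z) := by linarith
      rw [e, dvd_neg]
      exact dvd_add hy.1 hz.1
    have h0 : x = 0 := Int.eq_zero_of_abs_lt_dvd hd (by linarith [hx.2.2])
    have h1 := hx.2.1
    rw [h0, abs_zero] at h1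
    linarith

theorem triad_same_block {j l m : ℕ} {b c : Freq} (hb : b ∈ freqs l) (hc : c ∈ freqs m)
    (hbc : b + c ∈ freqs j) : l = j ∧ m = j := by
  have ha := isMode_of_mem (neg_mem_freqs hbc)
  have hb' := isMode_of_mem hb
  have hc' := isMode_of_mem hc
  simp only [Pi.neg_apply, Pi.add_apply] at ha
  have h1 := ha.not_lt_and_le hb' hc' (by ring)
  have h2 := ha.not_lt_and_le hc' hb' (by ring)
  have h3 := hb'.not_lt_and_le ha hc' (by ring)
  have h4 := hb'.not_lt_and_le hc' ha (by ring)
  have h5 := hc'.not_lt_and_le ha hb' (by ring)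
  have h6 := hc'.not_lt_and_le hb' ha (by ring)
  omega

/-- Tested against a filtered block, the advection term sees only that block. -/
theorem sum_integral_block_mul_advection {κ : Freq → ℝ} (hκ : ∀ α, κ (-α) = κ α) (j : ℕ) :
    ∑ i, ∫ x, trigPoly (freqs j) (fun α => κ α * velCoeff (psi j) i α) x *
      (advection flow flowGrad i x : ℂ) ∂torusMeasure =
    ((∑ b ∈ freqs j, ∑ c ∈ freqs j, interaction κ (psi j) (psi j) (psi j) b c : ℝ) : ℂ) := by
  have h1 := hasSum_sum fun i (_ : i ∈ Finset.univ) => hasSum_integral_mul_advection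
    (continuous_trigPoly (freqs j) (fun α => κ α * velCoeff (psi j) i α)) i
  simp_rw [ofReal_vel, ofReal_grad] at h1
  refine h1.unique ?_
  have h2 : ∀ p : ℕ × ℕ, ∑ i, ∑ i', ∫ x,
      trigPoly (freqs j) (fun α => κ α * velCoeff (psi j) i α) x *
        (trigPoly (freqs p.1) (velCoeff (psi p.1) i') x *
          trigPoly (freqs p.2) (gradCoeff (psi p.2) i i') x) ∂torusMeasure =
      ((∑ b ∈ freqs p.1, ∑ c ∈ freqs p.2, interaction κ (psi j) (psi p.1) (psi p.2) b c : ℝ) : ℂ) :=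
    fun p => integral_trilinear (fun _ => psi_eq_zero) (psi_neg j) hκ
  simp_rw [h2]
  refine hasSum_single (j, j) ?_
  rintro ⟨l, m⟩ hne
  rw [Complex.ofReal_eq_zero]
  refine Finset.sum_eq_zero fun b hb => Finset.sum_eq_zero fun c hc => ?_
  -- For a pair of blocks other than `(j, j)` the output frequency never falls in block `j`.
  have : psi j (b + c) = 0 := by
    refine psi_eq_zero fun hbc => hne ?_
    obtain ⟨h3, h4⟩ := triad_same_block hb hc hbc
    exact Prod.ext h3 h4
  simp [interaction, this]

/-! ### The energy flux -/

theorem freq_neg (α : Freq) : freq (-α) = -freq α := by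
  ext i; simp [freq]

theorem cutoff_neg {χ : Plane → ℝ} (hχ : IsCutoff χ) (q : ℕ) (α : Freq) :
    χ (((2 : ℝ) ^ q)⁻¹ • freq (-α)) = χ (((2 : ℝ) ^ q)⁻¹ • freq α) :=
  hχ.radial _ _ (by rw [freq_neg, smul_neg, norm_neg])

theorem mem_box_of_cutoff_ne_zero {χ : Plane → ℝ} (hχ : IsCutoff χ) {q N : ℕ} (hN : 2 ^ q ≤ N)
    {α : Freq} (h : χ (((2 : ℝ) ^ q)⁻¹ • freq α) ≠ 0) : α ∈ box N := by
  have h1 : ‖freq α‖ / 2 ^ q ≤ 1 := by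
    rw [← norm_dyadic]
    by_contra hc
    exact h (cutoff_eq_zero hχ (not_le.1 hc))
  rw [div_le_one (by positivity)] at h1
  rw [mem_box]
  intro i
  have h2 := (abs_le_norm_freq α i).trans h1
  have h3 : ((2 ^ q : ℕ) : ℝ) ≤ N := by exact_mod_cast hN
  push_cast at h3
  exact_mod_cast h2.trans h3

/-- `N` is left free so that one box can contain both the support of the multiplier and all blocks
up to the current one. -/
theorem lpTruncation_eq {χ : Plane → ℝ} (hχ : IsCutoff χ) {q N : ℕ} (hN : 2 ^ q ≤ N)
    (f : Torus2 → ℝ) : lpTruncation χ q f = trigPoly (box N) fun α =>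
      (χ (((2 : ℝ) ^ q)⁻¹ • freq α) : ℂ) * mFourierCoeff (fun y => (f y : ℂ)) α := by
  funext x
  rw [lpTruncation, dyadicMultiplier, trigPoly, tsum_eq_sum]
  intro α hα
  have : χ (((2 : ℝ) ^ q)⁻¹ • freq α) = 0 := by
    by_contra hne
    exact hα (mem_box_of_cutoff_ne_zero hχ hN hne)
  simp [this]

/-- Since `χ` is even, the truncation of `g` can be moved onto `f`, squaring the multiplier. The
advection term then appears unfiltered and can be expanded into pairs of blocks. -/
theorem integral_lpTruncation_mul {χ : Plane → ℝ} (hχ : IsCutoff χ) {q N : ℕ} (hN : 2 ^ q ≤ N)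
    (f : Torus2 → ℝ) {g : Torus2 → ℝ} (hg : Integrable g torusMeasure) :
    ∫ x, lpTruncation χ q f x * lpTruncation χ q g x ∂torusMeasure =
      ∫ x, trigPoly (box N) (fun α => ((χ (((2 : ℝ) ^ q)⁻¹ • freq α) ^ 2 : ℝ) : ℂ) *
        mFourierCoeff (fun y => (f y : ℂ)) α) x * (g x : ℂ) ∂torusMeasure := by
  rw [lpTruncation_eq hχ hN f, lpTruncation_eq hχ hN g]
  set d : Freq → ℂ := fun α =>
      (χ (((2 : ℝ) ^ q)⁻¹ • freq α) : ℂ) * mFourierCoeff (fun y => (g y : ℂ)) α with hd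
  have hdc := continuous_trigPoly (box N) d
  have e1 : ∀ x, trigPoly (box N) (fun α => (χ (((2 : ℝ) ^ q)⁻¹ • freq α) : ℂ) *
      mFourierCoeff (fun y => (f y : ℂ)) α) x * trigPoly (box N) d x =
      ∑ α ∈ box N, ((χ (((2 : ℝ) ^ q)⁻¹ • freq α) : ℂ) *
        mFourierCoeff (fun y => (f y : ℂ)) α) * (mFourier α x * trigPoly (box N) d x) := by
    intro x
    rw [trigPoly, Finset.sum_mul]
    exact Finset.sum_congr rfl fun α _ => by ring
  have e2 : ∀ x, trigPoly (box N) (fun α => ((χ (((2 : ℝ) ^ q)⁻¹ • freq α) ^ 2 : ℝ) : ℂ) *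
      mFourierCoeff (fun y => (f y : ℂ)) α) x * (g x : ℂ) =
      ∑ α ∈ box N, (((χ (((2 : ℝ) ^ q)⁻¹ • freq α) ^ 2 : ℝ) : ℂ) *
        mFourierCoeff (fun y => (f y : ℂ)) α) * (mFourier α x * (g x : ℂ)) := by
    intro x
    rw [trigPoly, Finset.sum_mul]
    exact Finset.sum_congr rfl fun α _ => by ring
  simp_rw [e1, e2]
  have hint : ∀ α ∈ box N, Integrable (fun x =>
      (((χ (((2 : ℝ) ^ q)⁻¹ • freq α) ^ 2 : ℝ) : ℂ) *
        mFourierCoeff (fun y => (f y : ℂ)) α) * (mFourier α x * (g x : ℂ))) torusMeasure :=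
    fun α _ => (Integrable.bdd_mul hg.ofReal
      (by fun_prop : AEStronglyMeasurable (fun x => mFourier α x) torusMeasure)
      (ae_of_all _ (norm_mFourier_apply_le α))).const_mul _
  rw [integral_finsetSum _ fun α _ => integrable_of_continuous (by fun_prop),
    integral_finsetSum _ hint]
  refine Finset.sum_congr rfl fun α hα => ?_
  rw [integral_const_mul, integral_const_mul, integral_mFourier_mul_trigPoly,
    if_pos (neg_mem_box hα), hd]
  simp only [cutoff_neg hχ, mFourierCoeff_eq, neg_neg]
  push_cast
  ring

/-! ### The flux at the scale of a block -/

section FluxScale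

variable {χ : Plane → ℝ} {q k : ℕ}

theorem cutoff_eq_one_of_norm_le (hχ : IsCutoff χ) (hq : (2 : ℝ) ^ q = 64 * freqScale k) {α : Freq}
    (h : ‖freq α‖ ≤ 32 * freqScale k) : χ (((2 : ℝ) ^ q)⁻¹ • freq α) = 1 := by
  refine hχ.eq_one _ ?_
  rw [norm_dyadic, div_le_iff₀ (by positivity), hq]
  linarith

theorem cutoff_eq_zero_of_lt_norm (hχ : IsCutoff χ) (hq : (2 : ℝ) ^ q = 64 * freqScale k)
    {α : Freq} (h : 64 * freqScale k < ‖freq α‖) : χ (((2 : ℝ) ^ q)⁻¹ • freq α) = 0 := by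
  refine cutoff_eq_zero hχ ?_
  rwa [norm_dyadic, lt_div_iff₀ (by positivity), one_mul, hq]

theorem cutoff_lower_block (hχ : IsCutoff χ) (hq : (2 : ℝ) ^ q = 64 * freqScale k) {j : ℕ}
    (hj : j < k) {α : Freq} (hα : α ∈ freqs j) : χ (((2 : ℝ) ^ q)⁻¹ • freq α) = 1 := by
  refine cutoff_eq_one_of_norm_le hχ hq ((norm_freq_le_of_mem hα).trans ?_)
  have := freqScale_le_real hj
  have h0 : (0 : ℝ) ≤ freqScale j := by positivity
  linarith

theorem cutoff_higher_block (hχ : IsCutoff χ) (hq : (2 : ℝ) ^ q = 64 * freqScale k) {l : ℕ}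
    (hl : k < l) {α : Freq} (hα : α ∈ freqs l) : χ (((2 : ℝ) ^ q)⁻¹ • freq α) = 0 := by
  refine cutoff_eq_zero_of_lt_norm hχ hq (lt_of_lt_of_le ?_ (le_norm_freq_of_mem hα))
  have := freqScale_le_real hl
  have h0 : (0 : ℝ) < freqScale k := by exact_mod_cast freqScale_pos k
  linarith

theorem abs_offset_le {β : Freq} (hβ : β ∈ box (2 * scale k)) (i : Fin 2) :
    |(β i : ℝ)| ≤ 2 * scale k := by
  exact_mod_cast mem_box.1 hβ i

/-- The coordinates add up to at most `24 + 2 + 2 = 28` frequency scales, inside the radius 32 where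
the cut-off is 1. -/
theorem cutoff_axis_node (hχ : IsCutoff χ) (hq : (2 : ℝ) ^ q = 64 * freqScale k) {z β : Freq}
    (hz : z = ![3, 0] ∨ z = ![-3, 0]) (hβ : β ∈ box (2 * scale k)) :
    χ (((2 : ℝ) ^ q)⁻¹ • freq (node (spacing k) (scale k) z β)) = 1 := by
  refine cutoff_eq_one_of_norm_le hχ hq ((norm_freq_le _).trans ?_)
  have h0 := abs_le.1 (abs_offset_le hβ 0)
  have h1 := abs_le.1 (abs_offset_le hβ 1)
  have hs : (0 : ℝ) ≤ scale k := by positivity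
  simp only [node, freqScale]
  push_cast
  rw [abs_mul, abs_mul, Nat.abs_cast, ← mul_add]
  have key : |8 * (scale k : ℝ) * (z 0 : ℝ) + (β 0 : ℝ)| + |8 * (scale k : ℝ) * (z 1 : ℝ) + (β 1 : ℝ)|
      ≤ 32 * scale k := by
    have e0 : |8 * (scale k : ℝ) * (z 0 : ℝ) + (β 0 : ℝ)| ≤ 26 * scale k := by
      rw [abs_le]
      rcases hz with rfl | rfl <;> simp <;> constructor <;> linarith
    have e1 : |8 * (scale k : ℝ) * (z 1 : ℝ) + (β 1 : ℝ)| ≤ 2 * scale k := by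
      rw [abs_le]
      rcases hz with rfl | rfl <;> simp <;> constructor <;> linarith
    linarith
  calc (spacing k : ℝ) * _ ≤ spacing k * (32 * scale k) := by gcongr
    _ = _ := by ring

/-- The second coordinate alone is at least `72 - 2 = 70` frequency scales, beyond the cut-off
radius 64. No mode of the block sees the transition region of `χ`. -/
theorem cutoff_other_node (hχ : IsCutoff χ) (hq : (2 : ℝ) ^ q = 64 * freqScale k) {z β : Freq}
    (hz : z ∈ centers) (hz' : ¬(z = ![3, 0] ∨ z = ![-3, 0])) (hβ : β ∈ box (2 * scale k)) :
    χ (((2 : ℝ) ^ q)⁻¹ • freq (node (spacing k) (scale k) z β)) = 0 := by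
  refine cutoff_eq_zero_of_lt_norm hχ hq (lt_of_lt_of_le ?_ (abs_le_norm_freq _ 1))
  have hz1 : ∀ z ∈ centers, ¬(z = ![3, 0] ∨ z = ![-3, 0]) → z 1 = 9 ∨ z 1 = -9 := by decide
  have h1 := abs_le.1 (abs_offset_le hβ 1)
  have hs : (0 : ℝ) < scale k := by exact_mod_cast scale_pos k
  have hM : (0 : ℝ) < spacing k := by exact_mod_cast spacing_pos k
  simp only [node, freqScale]
  push_cast
  rw [abs_mul, Nat.abs_cast]
  have key : 64 * (scale k : ℝ) < |8 * (scale k : ℝ) * (z 1 : ℝ) + (β 1 : ℝ)| := by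
    rw [lt_abs]
    rcases hz1 z hz hz' with h | h <;> rw [h] <;> push_cast
    · left; linarith
    · right; linarith
  calc 64 * ((spacing k : ℝ) * scale k) = spacing k * (64 * scale k) := by ring
    _ < _ := by gcongr

theorem freqs_subset_box {j : ℕ} (hj : j ≤ k) : freqs j ⊆ box (74 * freqScale k) := by
  intro α hα
  rw [mem_box]
  intro i
  have h1 := abs_le_of_mem_block hα i
  have h2 : freqScale j ≤ freqScale k := by
    rcases hj.lt_or_eq with h | rfl
    · have := freqScale_le_freqScale h; omega
    · exact le_rfl
  have h3 : (freqScale j : ℤ) ≤ freqScale k := by exact_mod_cast h2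
  push_cast
  refine h1.trans ?_
  change 74 * (freqScale j : ℤ) ≤ _
  linarith

theorem truncated_coeff_eq (hχ : IsCutoff χ) (hq : (2 : ℝ) ^ q = 64 * freqScale k) (i : Fin 2)
    (α : Freq) :
    ((χ (((2 : ℝ) ^ q)⁻¹ • freq α) ^ 2 : ℝ) : ℂ) * mFourierCoeff (fun y => (flow y i : ℂ)) α =
      ∑ j ∈ Finset.range (k + 1),
        ((χ (((2 : ℝ) ^ q)⁻¹ • freq α) ^ 2 : ℝ) : ℂ) * velCoeff (psi j) i α := by
  by_cases hα : ∃ l, α ∈ freqs l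
  · obtain ⟨l, hl⟩ := hα
    rcases Nat.lt_or_ge k l with hkl | hkl
    · simp [cutoff_higher_block hχ hq hkl hl]
    · rw [mFourierCoeff_flow_of_mem hl, Finset.sum_eq_single_of_mem l
        (Finset.mem_range.2 (by omega))]
      intro j _ hj
      rw [velCoeff_psi_eq_zero (fun h => hj (freqs_disjoint h hl)), mul_zero]
  · rw [not_exists] at hα
    rw [mFourierCoeff_flow_of_notMem hα, Finset.sum_eq_zero, mul_zero]
    intro j _
    rw [velCoeff_psi_eq_zero (hα j), mul_zero]

theorem trigPoly_truncated_eq (hχ : IsCutoff χ) (hq : (2 : ℝ) ^ q = 64 * freqScale k) (i : Fin 2)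
    (x : Torus2) :
    trigPoly (box (74 * freqScale k)) (fun α => ((χ (((2 : ℝ) ^ q)⁻¹ • freq α) ^ 2 : ℝ) : ℂ) *
      mFourierCoeff (fun y => (flow y i : ℂ)) α) x =
    ∑ j ∈ Finset.range (k + 1), trigPoly (freqs j) (fun α =>
      ((χ (((2 : ℝ) ^ q)⁻¹ • freq α) ^ 2 : ℝ) : ℂ) * velCoeff (psi j) i α) x := by
  simp only [trigPoly, truncated_coeff_eq hχ hq, Finset.sum_mul]
  rw [Finset.sum_comm]
  refine Finset.sum_congr rfl fun j hj => ?_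
  symm
  refine Finset.sum_subset (freqs_subset_box (by have := Finset.mem_range.1 hj; omega)) ?_
  intro α _ hα
  rw [velCoeff_psi_eq_zero hα]
  simp

/-- Higher blocks are removed by the truncation; each lower block passes unchanged and so
contributes its untruncated exchange, which is zero. -/
theorem energyFlux_eq (hχ : IsCutoff χ) (hq : (2 : ℝ) ^ q = 64 * freqScale k) :
    energyFlux χ q flow flowGrad = ∑ b ∈ freqs k, ∑ c ∈ freqs k,
      interaction (fun α => χ (((2 : ℝ) ^ q)⁻¹ • freq α) ^ 2) (psi k) (psi k) (psi k) b c := by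
  set κ : Freq → ℝ := fun α => χ (((2 : ℝ) ^ q)⁻¹ • freq α) ^ 2 with hκ
  have hκneg : ∀ α, κ (-α) = κ α := fun α => by simp only [hκ, cutoff_neg hχ]
  have hN : 2 ^ q ≤ 74 * freqScale k := by
    have h1 : 2 ^ q = 64 * freqScale k := by exact_mod_cast hq
    omega
  have hadv : ∀ i, Integrable (fun x => (advection flow flowGrad i x : ℂ)) torusMeasure :=
    fun i => (integrable_advection i).ofReal
  have hmul : ∀ (s : Finset Freq) (c : Freq → ℂ) (i : Fin 2), Integrable (fun x =>
      trigPoly s c x * (advection flow flowGrad i x : ℂ)) torusMeasure := fun s c i =>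
    (hadv i).bdd_mul (continuous_trigPoly s c).aestronglyMeasurable
      (ae_of_all _ (norm_trigPoly_le s c))
  have hS : ∫ x, ∑ i, lpTruncation χ q (fun y => flow y i) x *
      lpTruncation χ q (advection flow flowGrad i) x ∂torusMeasure =
      ((∑ j ∈ Finset.range (k + 1), ∑ b ∈ freqs j, ∑ c ∈ freqs j,
        interaction κ (psi j) (psi j) (psi j) b c : ℝ) : ℂ) := by
    rw [integral_finsetSum]
    swap
    · intro i _
      rw [lpTruncation_eq hχ hN, lpTruncation_eq hχ hN]
      exact integrable_of_continuous ((continuous_trigPoly _ _).mul (continuous_trigPoly _ _))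
    simp_rw [integral_lpTruncation_mul hχ hN _ (integrable_advection _),
      trigPoly_truncated_eq hχ hq, Finset.sum_mul]
    have hsw : ∀ i, ∫ x, ∑ j ∈ Finset.range (k + 1), trigPoly (freqs j) (fun α =>
        (κ α : ℂ) * velCoeff (psi j) i α) x * (advection flow flowGrad i x : ℂ) ∂torusMeasure =
        ∑ j ∈ Finset.range (k + 1), ∫ x, trigPoly (freqs j) (fun α =>
        (κ α : ℂ) * velCoeff (psi j) i α) x * (advection flow flowGrad i x : ℂ) ∂torusMeasure :=
      fun i => integral_finsetSum _ fun j _ => hmul _ _ i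
    rw [Finset.sum_congr rfl fun i _ => hsw i, Finset.sum_comm]
    simp_rw [sum_integral_block_mul_advection hκneg]
    push_cast
    rfl
  rw [energyFlux, hS, Complex.ofReal_re, Finset.sum_range_succ, Finset.sum_eq_zero, zero_add]
  intro j hj
  refine sum_interaction_eq_zero (fun _ => psi_eq_zero) (fun _ => neg_mem_freqs) (psi_neg j) ?_
  intro α hα
  simp only [hκ, cutoff_lower_block hχ hq (Finset.mem_range.1 hj) hα, one_pow]

/-- The amplitude is chosen for this cancellation: with `h = hSeq k` and `g = gSeq k`, the bound `π
(M s)⁴ (D s²)³ (s / 2)⁴` equals `π (h g)¹² (h⁴ g⁸)⁻³ g¹² / 16 = π / 16`. -/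
theorem energyFlux_ge (hχ : IsCutoff χ) (hq : (2 : ℝ) ^ q = 64 * freqScale k) :
    Real.pi / 16 ≤ energyFlux χ q flow flowGrad := by
  rw [energyFlux_eq hχ hq]
  obtain ⟨τ, hτ⟩ : 4 ∣ scale k := by
    obtain ⟨e, he⟩ := exists_hSeq_eq_two_pow k
    have h8 := eight_le_hSeq k
    have h2 : 2 ∣ hSeq k := by
      rw [he]
      refine dvd_pow_self 2 ?_
      rintro rfl
      rw [he] at h8
      norm_num at h8
    have h3 : 2 ∣ gSeq k := dvd_pow h2 (by omega)
    calc 4 ∣ 2 ^ 3 := by norm_num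
      _ ∣ scale k := pow_dvd_pow_of_dvd h3 3
  have hτ0 : 0 < τ := by have := scale_pos k; omega
  have key := transfer_lower_bound (amplitude_nonneg k) (spacing_pos k) hτ0
    (κ := fun α => χ (((2 : ℝ) ^ q)⁻¹ • freq α) ^ 2)
    (by
      rw [← hτ]
      intro z hz β hβ
      simp only [cutoff_axis_node hχ hq hz hβ, one_pow])
    (by
      rw [← hτ]
      intro z hz hz' β hβ
      simp only [cutoff_other_node hχ hq hz hz' hβ]
      norm_num)
  rw [← hτ] at key
  refine le_trans (le_of_eq ?_) key
  have h1 : (hSeq k : ℝ) ≠ 0 := by exact_mod_cast (hSeq_pos k).ne'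
  have h2 : (gSeq k : ℝ) ≠ 0 := by exact_mod_cast (gSeq_pos k).ne'
  have hτr : (4 : ℝ) * τ = (gSeq k : ℝ) ^ 3 := by
    have : ((4 * τ : ℕ) : ℝ) = ((gSeq k ^ 3 : ℕ) : ℝ) := by rw [← hτ]; rfl
    push_cast at this
    exact this
  have hτr' : (2 : ℝ) * τ = (gSeq k : ℝ) ^ 3 / 2 := by linarith
  rw [hτr', hτr, amplitude, spacing]
  push_cast
  field_simp
  norm_num

end FluxScale

theorem exists_two_pow_eq (k : ℕ) : ∃ q, k ≤ q ∧ (2 : ℝ) ^ q = 64 * freqScale k := by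
  obtain ⟨e, he⟩ := exists_hSeq_eq_two_pow k
  have hex : ∃ q, 2 ^ q = 64 * freqScale k := by
    refine ⟨6 + (e * 3 + e * (k + 3) * 3), ?_⟩
    rw [freqScale, spacing, scale, gSeq, he]
    simp only [pow_add, pow_mul]
    norm_num
  obtain ⟨q, hq⟩ := hex
  refine ⟨q, ?_, by exact_mod_cast hq⟩
  have h1 : 8 ^ (k + 1) ≤ 2 ^ q := by
    rw [hq]
    calc 8 ^ (k + 1) ≤ hSeq k := eight_pow_le_hSeq k
      _ ≤ spacing k := Nat.le_self_pow (by norm_num) _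
      _ ≤ freqScale k := Nat.le_mul_of_pos_right _ (scale_pos k)
      _ ≤ 64 * freqScale k := by omega
  have h2 : 2 ^ k ≤ 2 ^ q := by
    refine le_trans ?_ h1
    calc 2 ^ k ≤ 8 ^ k := Nat.pow_le_pow_left (by norm_num) k
      _ ≤ 8 ^ (k + 1) := Nat.pow_le_pow_right (by norm_num) (by omega)
  exact (Nat.pow_le_pow_iff_right (by norm_num)).1 h2

/-- The limsup is taken in `EReal`, so the lower bound along the block scales suffices without an
upper bound on the flux. -/
theorem limsup_energyFlux_pos {χ : Plane → ℝ} (hχ : IsCutoff χ) :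
    0 < limsup (fun q : ℕ => (energyFlux χ q flow flowGrad : EReal)) atTop := by
  have hpos : (0 : EReal) < ((Real.pi / 16 : ℝ) : EReal) := by
    exact_mod_cast (by positivity : (0 : ℝ) < Real.pi / 16)
  refine hpos.trans_le (le_limsup_of_frequently_le' ?_)
  rw [frequently_atTop]
  intro n
  obtain ⟨q, hq, h2q⟩ := exists_two_pow_eq n
  exact ⟨q, hq, EReal.coe_le_coe_iff.2 (energyFlux_ge hχ h2q)⟩

end IntermittentFlow

end

theorem theorem3 (χ : Plane → ℝ) (hχ : IsCutoff χ) :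
    ∃ (u : Torus2 → Plane) (G : Torus2 → Matrix (Fin 2) (Fin 2) ℝ),
      IsDivergenceFree u ∧
      MemBesovTop χ (1 / 3) 3 u ∧
      (∀ p : ℝ≥0∞, 1 ≤ p → p < 3 / 2 → MemSobolevOne p u) ∧
      HasWeakGradient u G ∧
      (∀ i, Integrable (advection u G i) torusMeasure) ∧
      limsup (fun q : ℕ => (energyFlux χ q u G : EReal)) atTop ≠ 0 :=
  ⟨IntermittentFlow.flow, IntermittentFlow.flowGrad, IntermittentFlow.isDivergenceFree_flow,
    IntermittentFlow.memBesovTop_flow hχ,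
    fun _ hp hp' => IntermittentFlow.memSobolevOne_flow hp hp',
    IntermittentFlow.hasWeakGradient_flow, IntermittentFlow.integrable_advection,
    (IntermittentFlow.limsup_energyFlux_pos hχ).ne'⟩
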